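/- **Proposition 4.4.** Let $n\ge 3$ and let $M$ be a nonempty smooth (Hausdorff) $n$-manifold. Let $\mathscr F$ be a codimension one $C^\infty$ foliation of $M$ with isolated singularities, i.e. a discrete subset $Sing(\mathscr F)\subset M$ together with a codimension one $C^\infty$ foliation of $M\setminus Sing(\mathscr F)$, given by a maximal atlas of foliated charts $\phi=(x,y):U\to B^{n-1}\times B^1$ whose changes of coordinates locally have the form $(x,y)\mapsto(f(x,y),g(y))$. A *first integral* of $\mathscr F$ on an open set $V$ is a function $f$ such that the leaves of $\mathscr F|_V$ are the connected components of the level sets of $f$ in $V\setminus Sing(\mathscr F)$. A *saddle* of index $l$, $0<l<n$, is a singularity near which $\mathscr F$ has a smooth first integral for which it is the only critical point and is non-degenerate of index $l$. For $1<k<n$ put $$f_\epsilon(x)=-\sum_{i<k}\frac{x_i^2}{2}+\Big(\frac{x_k^3}{3}-\epsilon x_k\Big)+\sum_{j>k}\frac{x_j^2}{2},\qquad x\in\mathbb R^n .$$ Then $\mathscr F$ has a foliated chart, and for every foliated chart $\phi:U\to B^{n-1}\times B^1$ of $\mathscr F$ and every $k$ with $1<k<n$ there are a foliation $\widetilde{\mathscr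 F}$ of $M$ with isolated singularities, distinct points $p,q\in U$, a smooth chart $\psi:U\to\Omega\subset\mathbb R^n$, a smooth function $g:\Omega\to\mathbb R$, a compact set $K\subset\Omega$ and numbers $\epsilon'<0<\epsilon''$ such that: 1. $Sing(\widetilde{\mathscr F})=Sing(\mathscr F)\cup\{p,q\}$; the points $p$ and $q$ are saddles of $\widetilde{\mathscr F}$ of the consecutive indices $k$ and $k-1$ respectively. 2. $\widetilde{\mathscr F}$ and $\mathscr F$ agree (have the same foliated charts) on $M\setminus\psi^{-1}(K)$. 3. $f_{\epsilon'}\circ\psi$ is a first integral of $\mathscr F$ on $U$, and $g\circ\psi$ is a first integral of $\widetilde{\mathscr F}$ on $U$. Moreover $g=f_{\epsilon'}$ on $\Omega\setminus K$, while $g=f_{\epsilon''}$ near the segment from $\psi(p)=-\sqrt{\epsilon''}\,e_k$ to $\psi(q)=\sqrt{\epsilon''}\,e_k$. The only critical points of $g$ are $\psi(p)$ and $\psi(q)$; they are non-degenerate of index $k$ and $k-1$ respectively. 4. $p$ and $q$ connect transversely: for the (Euclidean) gradient field of $g$ on $\Omega$, let $\mathcal W^s(\psi(p))$ be the set of points whose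 forward trajectory stays in $\Omega$ and converges to $\psi(p)$, and $\mathcal W^u(\psi(q))$ the set of points whose backward trajectory stays in $\Omega$ and converges to $\psi(q)$. Then $\mathcal W^s(\psi(p))\cap\mathcal W^u(\psi(q))\neq\varnothing$, and near each point of this intersection both sets are smooth embedded submanifolds, whose tangent spaces at that point span $\mathbb R^n$. -/

import Mathlib

open scoped Manifold ContDiff Topology

noncomputable section

/-- The model space `ℝⁿ` with `n = m + 1`. -/
abbrev RSp (m : ℕ) : Type := EuclideanSpace ℝ (Fin (m + 1))

/-- The open box `B^(n-1) × B^1` in `ℝⁿ`, `n = m + 1`: the product of the open unit ball in the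
first `m` coordinates and the open interval `(-1, 1)` in the last coordinate. -/
def unitBox (m : ℕ) : Set (RSp m) :=
  {z | ∑ i : Fin m, z i.castSucc ^ 2 < 1 ∧ |z (Fin.last m)| < 1}

section Foliations

variable {m : ℕ} {M : Type*} [TopologicalSpace M] [ChartedSpace (RSp m) M]

/-- The distinguished map of a chart: its last coordinate `y`, in `φ = (x, y)`. -/
def lastCoord (φ : OpenPartialHomeomorph M (RSp m)) (x : M) : ℝ := φ x (Fin.last m)

/-- The change of coordinates from `φ` to `χ` has, near each point of the overlap, the form
`(x, y) ↦ (f (x, y), g y)`. For charts of the smooth structure, `f` and `g` are then automatically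
smooth; `g` is a local diffeomorphism if the condition holds in both directions. -/
def FoliatedCompatible (φ χ : OpenPartialHomeomorph M (RSp m)) : Prop :=
  ∀ x ∈ φ.source ∩ χ.source, ∃ g : ℝ → ℝ, ∀ᶠ y in 𝓝 x, lastCoord χ y = g (lastCoord φ y)

variable (m M) in
/-- A codimension one, `C^∞` foliation with isolated singularities of the smooth manifold `M` of
dimension `n = m + 1`: a discrete subset `sing`, and a foliation of the complement of `sing`, given
by its maximal atlas of foliated charts. (`sing` is closed, since the foliated charts cover its
complement by open sets that do not meet it.) -/
structure SingFoliation where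
  /-- the singular set -/
  sing : Set M
  /-- the foliated charts -/
  charts : Set (OpenPartialHomeomorph M (RSp m))
  isDiscrete_sing : IsDiscrete sing
  smooth : ∀ φ ∈ charts, φ ∈ IsManifold.maximalAtlas (𝓡 (m + 1)) ∞ M
  target_eq : ∀ φ ∈ charts, φ.target = unitBox m
  source_subset : ∀ φ ∈ charts, φ.source ⊆ singᶜ
  cover : ∀ x ∉ sing, ∃ φ ∈ charts, x ∈ φ.source
  compatible : ∀ φ ∈ charts, ∀ χ ∈ charts, FoliatedCompatible φ χ
  maximal : ∀ φ ∈ IsManifold.maximalAtlas (𝓡 (m + 1)) ∞ M,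
    φ.target = unitBox m → φ.source ⊆ singᶜ →
    (∀ χ ∈ charts, FoliatedCompatible φ χ ∧ FoliatedCompatible χ φ) → φ ∈ charts

namespace SingFoliation

/-- `x` and `y` lie on a common plaque of the restriction of the foliation to `U`. -/
def SamePlaque (F : SingFoliation m M) (U : Set M) (x y : M) : Prop :=
  ∃ φ ∈ F.charts, φ.source ⊆ U ∧ x ∈ φ.source ∧ y ∈ φ.source ∧ lastCoord φ x = lastCoord φ y

/-- The leaf through `x` of the restriction of the foliation to the open set `U`: the points that
can be reached from `x` through a finite chain of plaques contained in `U`. -/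
def leafIn (F : SingFoliation m M) (U : Set M) (x : M) : Set M :=
  {y | Relation.ReflTransGen (F.SamePlaque U) x y}

/-- `f` is a first integral of the restriction of the foliation to the open set `U`: the leaves of
this restriction are the connected components of the level sets of `f` in `U \ sing`. -/
def IsFirstIntegral (F : SingFoliation m M) (U : Set M) (f : M → ℝ) : Prop :=
  ∀ x ∈ U \ F.sing, F.leafIn U x = connectedComponentIn {y ∈ U \ F.sing | f y = f x} x

/-- The two foliations agree on the open set `V`: they have the same foliated charts in `V`. -/
def AgreeOn (F G : SingFoliation m M) (V : Set M) : Prop :=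
  ∀ χ : OpenPartialHomeomorph M (RSp m), χ.source ⊆ V → (χ ∈ F.charts ↔ χ ∈ G.charts)

end SingFoliation

end Foliations

/-- `a` is a non-degenerate critical point of index `l` of `g`: the differential vanishes at `a`,
the Hessian at `a` is a non-degenerate bilinear form, and `l` is the greatest dimension of a
subspace on which it is negative definite. -/
def IsNondegCriticalPoint {m : ℕ} (g : RSp m → ℝ) (a : RSp m) (l : ℕ) : Prop :=
  fderiv ℝ g a = 0 ∧
  (∀ v, (∀ w, fderiv ℝ (fderiv ℝ g) a v w = 0) → v = 0) ∧
  IsGreatest {d : ℕ | ∃ V : Submodule ℝ (RSp m), Module.finrank ℝ V = d ∧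
    ∀ v ∈ V, v ≠ 0 → fderiv ℝ (fderiv ℝ g) a v v < 0} l

namespace SingFoliation

variable {m : ℕ} {M : Type*} [TopologicalSpace M] [ChartedSpace (RSp m) M]

/-- `p` is a Morse singularity of index `l`: near `p` there is a smooth local first integral whose
only critical point is `p`, and `p` is a non-degenerate critical point of index `l` of it. -/
def IsMorseSingularity (F : SingFoliation m M) (p : M) (l : ℕ) : Prop :=
  ∃ U : Set M, IsOpen U ∧ U ∩ F.sing = {p} ∧ ∃ f : M → ℝ,
    ContMDiffOn (𝓡 (m + 1)) 𝓘(ℝ, ℝ) ∞ f U ∧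
    (∀ x ∈ U, mfderiv (𝓡 (m + 1)) 𝓘(ℝ, ℝ) f x = 0 ↔ x = p) ∧
    IsNondegCriticalPoint (f ∘ (chartAt (RSp m) p).symm) (chartAt (RSp m) p p) l ∧
    F.IsFirstIntegral U f

/-- A saddle of index `l`: a Morse singularity with `0 < l < n`, where `n = m + 1 = dim M`. -/
def IsSaddle (F : SingFoliation m M) (p : M) (l : ℕ) : Prop :=
  F.IsMorseSingularity p l ∧ 0 < l ∧ l < m + 1

end SingFoliation

section Gradient

variable {m : ℕ}

/-- The stable manifold of `a` for the gradient field of `g` on the open set `Ω`: the points whose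
forward trajectory stays in `Ω` for all times and converges to `a`. -/
def gradStable (g : RSp m → ℝ) (Ω : Set (RSp m)) (a : RSp m) : Set (RSp m) :=
  {x | ∃ γ : ℝ → RSp m, γ 0 = x ∧
    (∀ t, 0 ≤ t → γ t ∈ Ω ∧ HasDerivWithinAt γ (gradient g (γ t)) (Set.Ici 0) t) ∧
    Filter.Tendsto γ Filter.atTop (𝓝 a)}

/-- The unstable manifold of `a` for the gradient field of `g` on the open set `Ω`: the points whose
backward trajectory stays in `Ω` for all times and converges to `a`. -/
def gradUnstable (g : RSp m → ℝ) (Ω : Set (RSp m)) (a : RSp m) : Set (RSp m) :=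
  {x | ∃ γ : ℝ → RSp m, γ 0 = x ∧
    (∀ t, t ≤ 0 → γ t ∈ Ω ∧ HasDerivWithinAt γ (gradient g (γ t)) (Set.Iic 0) t) ∧
    Filter.Tendsto γ Filter.atBot (𝓝 a)}

/-- Near its point `x`, the set `S` is a smooth embedded submanifold with tangent space `T` at `x`:
a smooth chart `e` around `x` straightens `S` to a linear subspace `V`, and `T` is the preimage of
`V` under the differential of `e` at `x`. -/
def HasTangentSpaceAt (S : Set (RSp m)) (x : RSp m) (T : Submodule ℝ (RSp m)) : Prop :=
  x ∈ S ∧ ∃ e : OpenPartialHomeomorph (RSp m) (RSp m), x ∈ e.source ∧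
    ContDiffOn ℝ ∞ e e.source ∧ ContDiffOn ℝ ∞ e.symm e.target ∧
    ∃ V : Submodule ℝ (RSp m), (∀ y ∈ e.source, e y ∈ V ↔ y ∈ S) ∧
      T = V.comap (fderiv ℝ e x : RSp m →ₗ[ℝ] RSp m)

/-- Near each of their common points, `S` and `S'` are smooth embedded submanifolds whose tangent
spaces at this point span the whole space. -/
def IntersectTransversely (S S' : Set (RSp m)) : Prop :=
  ∀ x ∈ S ∩ S', ∃ T T' : Submodule ℝ (RSp m),
    HasTangentSpaceAt S x T ∧ HasTangentSpaceAt S' x T' ∧ T ⊔ T' = ⊤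

/-- The local model
`f_ε (x) = - ∑_{i < k} x_i² / 2 + (x_k³ / 3 - ε x_k) + ∑_{i > k} x_i² / 2`
(coordinates are numbered from `0` to `m`, so that there are `k` indices `i < k`). -/
def modelFn (k : Fin (m + 1)) (ε : ℝ) (x : RSp m) : ℝ :=
  -(∑ i ∈ Finset.Iio k, x i ^ 2 / 2) + (x k ^ 3 / 3 - ε * x k) + ∑ i ∈ Finset.Ioi k, x i ^ 2 / 2

end Gradient

/-- `p` and `q` connect transversely: in the coordinates `ψ`, the foliation is given on the domain
of `ψ` by a smooth first integral `g` without critical points other than `p` and `q`, and for the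
gradient of `g`, which is transverse to the foliation away from `p` and `q`, the stable manifold of
`p` and the unstable manifold of `q` meet, and do so transversely. -/
structure SingFoliation.ConnectTransversely {m : ℕ} {M : Type*} [TopologicalSpace M]
    [ChartedSpace (RSp m) M] (F : SingFoliation m M) (ψ : OpenPartialHomeomorph M (RSp m))
    (g : RSp m → ℝ) (p q : M) : Prop where
  smooth_chart : ψ ∈ IsManifold.maximalAtlas (𝓡 (m + 1)) ∞ M
  left_mem : p ∈ ψ.source
  right_mem : q ∈ ψ.source
  smooth : ContDiffOn ℝ ∞ g ψ.target
  firstIntegral : F.IsFirstIntegral ψ.source (g ∘ ψ)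
  critical : ∀ z ∈ ψ.target, gradient g z = 0 ↔ z = ψ p ∨ z = ψ q
  nonempty : (gradStable g ψ.target (ψ p) ∩ gradUnstable g ψ.target (ψ q)).Nonempty
  transverse : IntersectTransversely (gradStable g ψ.target (ψ p)) (gradUnstable g ψ.target (ψ q))

end

/-! In the box coordinates of a foliated chart, the plaques are the level sets of the last
coordinate. Since `s ↦ s³ / 3 + s` is a diffeomorphism of the line, the model function
`modelFn k (-1)`, together with the coordinates of index `≠ k`, is a global system of coordinates
(`exists_box_coordinates`); so every foliated chart can be turned into a chart `ψ` in which the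
foliation is given by `modelFn k (-1)`, on a domain as large as needed.

Let `r²` be the sum of the squares of the coordinates of index `≠ k`, and `T` the smooth transition
function from `0` to `1`. The function
`g = modelFn k (-1) - 2 T (2 - λ r²) T (3 - x_k²) x_k` (`saddlePairFn`) is equal to `modelFn k 1`
near the segment between the critical points `± e_k` of that function, and to `modelFn k (-1)` off a
compact set. For `i ≠ k`, `∂ᵢ g = (± 1 + η) x_i` with `|η|` at most a constant times `λ`; for small
`λ`, `|η| < 1` (`exists_abs_twist_lt_one`). Moreover `∂ₖ g ≥ x_k² - 1`
(`sq_sub_one_le_gradient_saddlePairFn`), because the cut-off function `T (3 - x_k²)` takes values in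
`[0, 1]` and decreases as `|x_k|` grows. This implies that `g` has no critical points
but `± e_k`, and it controls the gradient flow: along a trajectory that converges to a point of the
axis forward in time, the coordinates with `i > k` have non-decreasing squares, hence vanish, and
likewise for the coordinates with `i < k` backward in time (`apply_eq_zero_of_tendsto`); and
`∂ₖ g ≥ (x_k - 1) (x_k + 1)` prevents trajectories from crossing the hyperplanes `x_k = ± 1` in the
decreasing direction. So the stable and the unstable manifold can only meet in the open segment
between the critical points. Near this segment the flow is explicit (`modelTraj`), which shows that
the two sets are there the linear subspaces `x_i = 0` for `i > k`, and `x_i = 0` for `i < k`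
(`intersectTransversely_saddlePairFn`).

The new foliation is described by germs. Two functions are locally equivalent if each is locally
a function of the other (`SameLevelGerm`). The charts of the new foliation are the smooth charts
onto the unit box whose last coordinate is locally equivalent to `g ∘ ψ` in the domain of `ψ`, and
to the last coordinates of the old foliated charts off the compact set
(`SingFoliation.exists_modification`); there are enough of them, because a function without critical
points is locally the last coordinate of a chart (`exists_chart_last_eq`). A function that is
locally equivalent to the last coordinates of the foliated charts is a first integral on every open set,
since the leaves are connected and open in its level sets
(`SingFoliation.isFirstIntegral_of_sameLevelGerm`). -/

noncomputable section

/-! ### Charts of the smooth structure -/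

theorem trans_mem_maximalAtlas {H M : Type*} [TopologicalSpace H] [TopologicalSpace M]
    [ChartedSpace H M] {G : StructureGroupoid H} {χ : OpenPartialHomeomorph M H}
    {e : OpenPartialHomeomorph H H} (hχ : χ ∈ G.maximalAtlas M) (he : e ∈ G) :
    χ.trans e ∈ G.maximalAtlas M := by
  rw [mem_maximalAtlas_iff] at hχ ⊢
  intro c hc
  obtain ⟨h1, h2⟩ := hχ c hc
  constructor
  · rw [OpenPartialHomeomorph.trans_symm_eq_symm_trans_symm, OpenPartialHomeomorph.trans_assoc]
    exact G.trans (G.symm he) h1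
  · rw [← OpenPartialHomeomorph.trans_assoc]
    exact G.trans h2 he

theorem mem_contDiffGroupoid_of_contDiffOn {n : ℕ}
    {e : OpenPartialHomeomorph (EuclideanSpace ℝ (Fin n)) (EuclideanSpace ℝ (Fin n))}
    (h : ContDiffOn ℝ ∞ e e.source) (h' : ContDiffOn ℝ ∞ e.symm e.target) :
    e ∈ contDiffGroupoid ∞ (𝓡 n) := by
  rw [contDiffGroupoid, mem_groupoid_of_pregroupoid]
  constructor
  · simpa [contDiffPregroupoid] using h
  · simpa [contDiffPregroupoid] using h'

section

variable {m : ℕ}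

theorem isOpen_unitBox : IsOpen (unitBox m) := by
  have h1 : Continuous fun z : RSp m => ∑ i : Fin m, z i.castSucc ^ 2 := by fun_prop
  have h2 : Continuous fun z : RSp m => |z (Fin.last m)| := by fun_prop
  exact (isOpen_lt h1 continuous_const).inter (isOpen_lt h2 continuous_const)

theorem zero_mem_unitBox : (0 : RSp m) ∈ unitBox m := by
  simp [unitBox]

theorem unitBox_subset_closedBall : unitBox m ⊆ Metric.closedBall 0 2 := by
  rintro z ⟨h1, h2⟩
  rw [mem_closedBall_zero_iff, EuclideanSpace.norm_eq, Fin.sum_univ_castSucc]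
  simp only [Real.norm_eq_abs, sq_abs]
  apply Real.sqrt_le_iff.2 ⟨by norm_num, _⟩
  have := abs_lt.1 h2
  nlinarith

/-- The slices of the box with constant last coordinate are connected. -/
theorem isPreconnected_unitBox_slice (c : ℝ) :
    IsPreconnected {z | z ∈ unitBox m ∧ z (Fin.last m) = c} := by
  apply Convex.isPreconnected
  rintro x ⟨⟨hx1, hx2⟩, hx3⟩ y ⟨⟨hy1, hy2⟩, hy3⟩ a b ha hb hab
  refine ⟨⟨?_, ?_⟩, ?_⟩
  · have key : ∑ i : Fin m, (a • x + b • y) i.castSucc ^ 2 ≤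
        a * ∑ i : Fin m, x i.castSucc ^ 2 + b * ∑ i : Fin m, y i.castSucc ^ 2 := by
      rw [Finset.mul_sum, Finset.mul_sum, ← Finset.sum_add_distrib]
      refine Finset.sum_le_sum fun i _ => ?_
      obtain rfl : b = 1 - a := by linarith
      simp only [PiLp.add_apply, PiLp.smul_apply, smul_eq_mul]
      nlinarith [mul_nonneg (mul_nonneg ha hb) (sq_nonneg (x i.castSucc - y i.castSucc))]
    rcases ha.eq_or_lt with rfl | ha
    · obtain rfl : b = 1 := by linarith
      linarith
    · nlinarith
  · have : (a • x + b • y) (Fin.last m) = c := by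
      simp only [PiLp.add_apply, PiLp.smul_apply, smul_eq_mul, hx3, hy3, ← add_mul, hab, one_mul]
    rw [this, ← hx3]
    exact hx2
  · simp only [PiLp.add_apply, PiLp.smul_apply, smul_eq_mul, hx3, hy3, ← add_mul, hab, one_mul]

variable {M : Type*} [TopologicalSpace M]

/-- Near `x`, each of the two functions is a function of the other: their level sets have the same
germs at points close to `x`. -/
def SameLevelGerm (u v : M → ℝ) (x : M) : Prop :=
  (∃ g : ℝ → ℝ, ∀ᶠ y in 𝓝 x, v y = g (u y)) ∧ ∃ g : ℝ → ℝ, ∀ᶠ y in 𝓝 x, u y = g (v y)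

namespace SameLevelGerm

theorem symm {u v : M → ℝ} {x : M} (h : SameLevelGerm u v x) : SameLevelGerm v u x := ⟨h.2, h.1⟩

theorem trans {u v w : M → ℝ} {x : M} (h : SameLevelGerm u v x) (h' : SameLevelGerm v w x) :
    SameLevelGerm u w x := by
  obtain ⟨⟨a, ha⟩, b, hb⟩ := h
  obtain ⟨⟨c, hc⟩, d, hd⟩ := h'
  refine ⟨⟨c ∘ a, ?_⟩, b ∘ d, ?_⟩
  · filter_upwards [ha, hc] with y h1 h2
    rw [h2, h1, Function.comp]
  · filter_upwards [hb, hd] with y h1 h2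
    rw [h1, h2, Function.comp]

theorem of_eventuallyEq {u v : M → ℝ} {x : M} (h : u =ᶠ[𝓝 x] v) : SameLevelGerm u v x :=
  ⟨⟨id, h.mono fun _ hy => hy.symm⟩, id, h⟩

theorem of_const_mul {u v : M → ℝ} {x : M} {c : ℝ} (hc : c ≠ 0) (h : ∀ᶠ y in 𝓝 x, v y = c * u y) :
    SameLevelGerm u v x := by
  refine ⟨⟨fun t => c * t, h⟩, fun t => c⁻¹ * t, h.mono fun y hy => ?_⟩
  dsimp only
  rw [hy, inv_mul_cancel_left₀ hc]

end SameLevelGerm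

theorem FoliatedCompatible.sameLevelGerm {φ χ : OpenPartialHomeomorph M (RSp m)}
    (h : FoliatedCompatible φ χ) (h' : FoliatedCompatible χ φ) {x : M} (hx : x ∈ φ.source)
    (hx' : x ∈ χ.source) : SameLevelGerm (lastCoord φ) (lastCoord χ) x :=
  ⟨h x ⟨hx, hx'⟩, h' x ⟨hx', hx⟩⟩

/-- The plaques of a chart onto the unit box are connected. -/
theorem isPreconnected_plaque {χ : OpenPartialHomeomorph M (RSp m)} (ht : χ.target = unitBox m)
    (c : ℝ) : IsPreconnected {z | z ∈ χ.source ∧ lastCoord χ z = c} := by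
  have : {z | z ∈ χ.source ∧ lastCoord χ z = c}
      = χ.symm '' {z | z ∈ unitBox m ∧ z (Fin.last m) = c} := by
    ext z
    constructor
    · rintro ⟨hz, hc⟩
      exact ⟨χ z, ⟨ht ▸ χ.map_source hz, hc⟩, χ.left_inv hz⟩
    · rintro ⟨w, ⟨hw, hc⟩, rfl⟩
      rw [← ht] at hw
      exact ⟨χ.map_target hw, by rw [lastCoord, χ.right_inv hw, hc]⟩
  rw [this]
  refine (isPreconnected_unitBox_slice c).image _ (χ.continuousOn_symm.mono ?_)
  rw [ht]
  exact fun z hz => hz.1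

variable [ChartedSpace (RSp m) M]

/-- A chart of the smooth structure can be cut down, around each of its points, to a chart onto the
unit box with the same horizontal plaques. -/
theorem exists_box_chart {χ₀ : OpenPartialHomeomorph M (RSp m)}
    (hχ₀ : χ₀ ∈ IsManifold.maximalAtlas (𝓡 (m + 1)) ∞ M) {x : M} (hx : x ∈ χ₀.source) {W : Set M}
    (hW : W ∈ 𝓝 x) :
    ∃ χ ∈ IsManifold.maximalAtlas (𝓡 (m + 1)) ∞ M, χ.target = unitBox m ∧ x ∈ χ.source ∧
      χ.source ⊆ χ₀.source ∩ W ∧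
      ∀ y ∈ χ.source, SameLevelGerm (lastCoord χ₀) (lastCoord χ) y := by
  have hnhds : χ₀.target ∩ χ₀.symm ⁻¹' W ∈ 𝓝 (χ₀ x) := by
    refine Filter.inter_mem (χ₀.open_target.mem_nhds (χ₀.map_source hx)) ?_
    have := χ₀.continuousAt_symm (χ₀.map_source hx)
    rw [ContinuousAt, χ₀.left_inv hx] at this
    exact this hW
  obtain ⟨δ, hδ, hball⟩ := Metric.mem_nhds_iff.1 hnhds
  have hδ' : δ / 4 ≠ 0 := by positivity
  -- the homothety that takes the unit box into the ball of radius `δ` around `χ₀ x`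
  let a : RSp m ≃ₜ RSp m :=
    (Homeomorph.smulOfNeZero (δ / 4) hδ').trans (Homeomorph.addLeft (χ₀ x))
  have ha : ∀ z, a z = χ₀ x + (δ / 4) • z := fun z => rfl
  have ha' : ∀ z, a.symm z = (δ / 4)⁻¹ • (-χ₀ x + z) := fun z => rfl
  have hbox : ∀ z ∈ unitBox m, a z ∈ χ₀.target ∩ χ₀.symm ⁻¹' W := by
    intro z hz
    apply hball
    have := mem_closedBall_zero_iff.1 (unitBox_subset_closedBall hz)
    rw [ha, mem_ball_iff_norm, add_sub_cancel_left, norm_smul, Real.norm_eq_abs,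
      abs_of_pos (by positivity)]
    nlinarith
  let e : OpenPartialHomeomorph (RSp m) (RSp m) :=
    (a.toOpenPartialHomeomorph.symm).trans (OpenPartialHomeomorph.ofSet _ isOpen_unitBox)
  have he : e ∈ contDiffGroupoid ∞ (𝓡 (m + 1)) := by
    apply mem_contDiffGroupoid_of_contDiffOn
    · have : ContDiff ℝ ∞ fun z : RSp m => (δ / 4)⁻¹ • (-χ₀ x + z) := by fun_prop
      exact this.contDiffOn
    · have : ContDiff ℝ ∞ fun z : RSp m => χ₀ x + (δ / 4) • z := by fun_prop
      exact this.contDiffOn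
  have hsrc : ∀ y, y ∈ (χ₀.trans e).source ↔ y ∈ χ₀.source ∧ a.symm (χ₀ y) ∈ unitBox m := by
    intro y
    simp [e]
  refine ⟨χ₀.trans e, trans_mem_maximalAtlas hχ₀ he, ?_, ?_, ?_, ?_⟩
  · ext z
    have : z ∈ (χ₀.trans e).target ↔ z ∈ unitBox m ∧ a z ∈ χ₀.target := by
      simp [e]
    rw [this]
    exact ⟨fun h => h.1, fun h => ⟨h, (hbox z h).1⟩⟩
  · rw [hsrc, ha', neg_add_cancel, smul_zero]
    exact ⟨hx, zero_mem_unitBox⟩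
  · intro y hy
    rw [hsrc] at hy
    refine ⟨hy.1, ?_⟩
    have := (hbox _ hy.2).2
    rwa [Homeomorph.apply_symm_apply, Set.mem_preimage, χ₀.left_inv hy.1] at this
  · intro y hy
    have key : ∀ y, lastCoord (χ₀.trans e) y
        = (δ / 4)⁻¹ * (-(χ₀ x (Fin.last m)) + lastCoord χ₀ y) := fun y => rfl
    refine ⟨⟨fun t => (δ / 4)⁻¹ * (-(χ₀ x (Fin.last m)) + t), .of_forall key⟩,
      fun t => χ₀ x (Fin.last m) + (δ / 4) * t, .of_forall fun y => ?_⟩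
    dsimp only
    rw [key, mul_inv_cancel_left₀ hδ']
    ring

/-! ### Leaves and first integrals -/

namespace SingFoliation

variable (F : SingFoliation m M)

theorem sameLevelGerm {φ χ : OpenPartialHomeomorph M (RSp m)} (hφ : φ ∈ F.charts)
    (hχ : χ ∈ F.charts) {x : M} (hx : x ∈ φ.source) (hx' : x ∈ χ.source) :
    SameLevelGerm (lastCoord φ) (lastCoord χ) x :=
  (F.compatible φ hφ χ hχ).sameLevelGerm (F.compatible χ hχ φ hφ) hx hx'

/-- A smooth chart onto the unit box belongs to the foliation as soon as it has locally the same
plaques as the foliated charts. -/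
theorem mem_charts_of_sameLevelGerm {φ : OpenPartialHomeomorph M (RSp m)}
    (hφ : φ ∈ IsManifold.maximalAtlas (𝓡 (m + 1)) ∞ M) (ht : φ.target = unitBox m)
    (hs : φ.source ⊆ F.singᶜ)
    (h : ∀ x ∈ φ.source, ∃ χ ∈ F.charts, x ∈ χ.source ∧
      SameLevelGerm (lastCoord φ) (lastCoord χ) x) : φ ∈ F.charts := by
  refine F.maximal φ hφ ht hs fun χ' hχ' => ⟨?_, ?_⟩
  · rintro x ⟨hx, hx'⟩
    obtain ⟨χ, hχ, hxχ, hg⟩ := h x hx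
    exact (hg.trans (F.sameLevelGerm hχ hχ' hxχ hx')).1
  · rintro x ⟨hx', hx⟩
    obtain ⟨χ, hχ, hxχ, hg⟩ := h x hx
    exact (hg.trans (F.sameLevelGerm hχ hχ' hxχ hx')).2

theorem isClosed_sing : IsClosed F.sing := by
  rw [← isOpen_compl_iff, isOpen_iff_mem_nhds]
  intro x hx
  obtain ⟨φ, hφ, hxφ⟩ := F.cover x hx
  exact Filter.mem_of_superset (φ.open_source.mem_nhds hxφ) (F.source_subset φ hφ)

theorem charts_nonempty [Nonempty M] : F.charts.Nonempty := by
  by_contra hne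
  have hall : ∀ x, x ∈ F.sing := by
    intro x
    by_contra hx
    obtain ⟨φ, hφ, -⟩ := F.cover x hx
    exact hne ⟨φ, hφ⟩
  obtain ⟨x⟩ := ‹Nonempty M›
  have hx : IsOpen ({x} : Set M) := by
    obtain ⟨V, hV, hVx⟩ := isDiscrete_iff_forall_mem_exists_isOpen.1 F.isDiscrete_sing x (hall x)
    rw [Set.eq_univ_of_forall hall, Set.inter_univ] at hVx
    exact hVx ▸ hV
  have h := (chartAt (RSp m) x).isOpen_image_of_subset_source hx
    (Set.singleton_subset_iff.2 (mem_chart_source _ x))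
  rw [Set.image_singleton, isOpen_singleton_iff_punctured_nhds] at h
  exact (Module.punctured_nhds_neBot ℝ (RSp m) (chartAt (RSp m) x x)).ne h

/-- Every regular point has arbitrarily small foliated charts. -/
theorem exists_chart_subset {x : M} (hx : x ∉ F.sing) {W : Set M} (hW : W ∈ 𝓝 x) :
    ∃ χ ∈ F.charts, x ∈ χ.source ∧ χ.source ⊆ W := by
  obtain ⟨φ, hφ, hxφ⟩ := F.cover x hx
  obtain ⟨χ, hχ, ht, hxχ, hs, hg⟩ := exists_box_chart (F.smooth φ hφ) hxφ hW
  refine ⟨χ, F.mem_charts_of_sameLevelGerm hχ ht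
    (fun y hy => F.source_subset φ hφ (hs hy).1) fun y hy => ⟨φ, hφ, (hs hy).1, (hg y hy).symm⟩,
    hxχ, fun y hy => (hs hy).2⟩

/-- A function whose level sets are locally the plaques of the foliation is a first integral: the
leaves are connected subsets of its level sets, and they are open in the level sets. -/
theorem isFirstIntegral_of_sameLevelGerm {W : Set M} (hW : IsOpen W) {u : M → ℝ}
    (h : ∀ χ ∈ F.charts, ∀ x ∈ χ.source, x ∈ W → SameLevelGerm (lastCoord χ) u x) :
    F.IsFirstIntegral W u := by
  intro x hx
  set S : Set M := {y ∈ W \ F.sing | u y = u x}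
  have hxS : x ∈ S := ⟨hx, rfl⟩
  have symm : ∀ {y z}, F.SamePlaque W y z → F.SamePlaque W z y := by
    rintro y z ⟨φ, hφ, hs, hy, hz, he⟩
    exact ⟨φ, hφ, hs, hz, hy, he.symm⟩
  -- plaques are connected subsets of the level sets
  have hplaque : ∀ y z, y ∈ S → F.SamePlaque W y z → z ∈ connectedComponentIn S y := by
    rintro y z hy ⟨χ, hχ, hs, hyχ, hzχ, he⟩
    set P : Set M := {w | w ∈ χ.source ∧ lastCoord χ w = lastCoord χ y}
    have hP : IsPreconnected P := isPreconnected_plaque (F.target_eq χ hχ) _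
    have hconst : ∀ w ∈ P, u w = u y := by
      intro w hw
      refine hP.induction₂' (fun a b => u a = u b) (fun a ha => ?_)
        (fun a b c _ _ _ hab hbc => hab.trans hbc) hw ⟨hyχ, rfl⟩
      obtain ⟨⟨g, hg⟩, -⟩ := h χ hχ a ha.1 (hs ha.1)
      filter_upwards [nhdsWithin_le_nhds hg, self_mem_nhdsWithin] with b hb hbP
      have : u a = u b := by
        rw [hb, hg.self_of_nhds, ha.2, hbP.2]
      exact ⟨this, this.symm⟩
    refine hP.subset_connectedComponentIn ⟨hyχ, rfl⟩ (fun w hw => ?_) ⟨hzχ, he.symm⟩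
    exact ⟨⟨hs hw.1, F.source_subset χ hχ hw.1⟩, (hconst w hw).trans hy.2⟩
  apply Set.Subset.antisymm
  · intro y hy
    change Relation.ReflTransGen (F.SamePlaque W) x y at hy
    induction hy with
    | refl => exact mem_connectedComponentIn hxS
    | @tail y z _ hyz ih =>
      rw [connectedComponentIn_eq ih]
      exact hplaque y z (connectedComponentIn_subset _ _ ih) hyz
  · intro y hy
    refine isPreconnected_connectedComponentIn.induction₂'
      (fun a b => Relation.ReflTransGen (F.SamePlaque W) a b) (fun a ha => ?_)
      (fun a b c _ _ _ hab hbc => hab.trans hbc) (mem_connectedComponentIn hxS) hy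
    have haS := connectedComponentIn_subset _ _ ha
    obtain ⟨χ, hχ, haχ, hsub⟩ := F.exists_chart_subset haS.1.2 (hW.mem_nhds haS.1.1)
    obtain ⟨-, g, hg⟩ := h χ hχ a haχ haS.1.1
    filter_upwards [nhdsWithin_le_nhds hg, self_mem_nhdsWithin,
      nhdsWithin_le_nhds (χ.open_source.mem_nhds haχ)] with b hb hbC hbχ
    have hbS := connectedComponentIn_subset _ _ hbC
    have : F.SamePlaque W a b := by
      refine ⟨χ, hχ, hsub, haχ, hbχ, ?_⟩
      rw [hb, hg.self_of_nhds, haS.2, hbS.2]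
    exact ⟨.single this, .single (symm this)⟩

/-! ### Modification of a foliation -/

/-- A foliation can be replaced, on an open set `U` of regular points, by the level sets of a
function `u` that is a submersion off a finite set `P`, as long as these level sets agree with the
given foliation off a closed subset `C` of `U`. -/
theorem exists_modification [T1Space M] {U C P : Set M} (hU : IsOpen U) (hC : IsClosed C)
    (hCU : C ⊆ U) (hP : P.Finite) (hPC : P ⊆ C) (hUs : U ⊆ F.singᶜ) {u : M → ℝ}
    (hsub : ∀ x ∈ U \ P, ∃ χ ∈ IsManifold.maximalAtlas (𝓡 (m + 1)) ∞ M,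
      x ∈ χ.source ∧ ∀ y ∈ χ.source, lastCoord χ y = u y)
    (hu : ∀ χ ∈ F.charts, ∀ x ∈ χ.source, x ∈ U → x ∉ C → SameLevelGerm (lastCoord χ) u x) :
    ∃ F' : SingFoliation m M, F'.sing = F.sing ∪ P ∧ F'.AgreeOn F Cᶜ ∧
      ∀ χ ∈ F'.charts, ∀ x ∈ χ.source, x ∈ U → SameLevelGerm (lastCoord χ) u x := by
  have hPd : IsDiscrete (F.sing ∪ P) :=
    F.isDiscrete_sing.union hP.isDiscrete F.isClosed_sing hP.isClosed
  let 𝒜 : Set (OpenPartialHomeomorph M (RSp m)) :=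
    {χ | χ ∈ IsManifold.maximalAtlas (𝓡 (m + 1)) ∞ M ∧ χ.target = unitBox m ∧
      χ.source ⊆ (F.sing ∪ P)ᶜ ∧
      (∀ x ∈ χ.source, x ∈ U → SameLevelGerm (lastCoord χ) u x) ∧
      ∀ χ' ∈ F.charts, ∀ x ∈ χ.source, x ∈ χ'.source → x ∉ C →
        SameLevelGerm (lastCoord χ) (lastCoord χ') x}
  have hcover : ∀ x ∉ F.sing ∪ P, ∃ χ ∈ 𝒜, x ∈ χ.source := by
    intro x hx
    by_cases hxU : x ∈ U
    · obtain ⟨χ₀, hχ₀, hxχ₀, hlast⟩ := hsub x ⟨hxU, fun h => hx (.inr h)⟩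
      obtain ⟨χ, hχ, ht, hxχ, hs, hg⟩ := exists_box_chart hχ₀ hxχ₀
        ((hU.sdiff hP.isClosed).mem_nhds ⟨hxU, fun h => hx (.inr h)⟩)
      have hgu : ∀ y ∈ χ.source, SameLevelGerm (lastCoord χ) u y := fun y hy =>
        (hg y hy).symm.trans (.of_eventuallyEq (Filter.eventually_of_mem
          (χ₀.open_source.mem_nhds (hs hy).1) hlast))
      refine ⟨χ, ⟨hχ, ht, ?_, fun y hy _ => hgu y hy, fun χ' hχ' y hy hy' hyC =>
        (hgu y hy).trans (hu χ' hχ' y hy' (hs hy).2.1 hyC).symm⟩, hxχ⟩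
      rintro y hy (h | h)
      exacts [hUs (hs hy).2.1 h, (hs hy).2.2 h]
    · have hxC : x ∉ C := fun h => hxU (hCU h)
      obtain ⟨χ, hχ, hxχ, hs⟩ := F.exists_chart_subset (fun h => hx (.inl h))
        (hC.isOpen_compl.mem_nhds hxC)
      refine ⟨χ, ⟨F.smooth χ hχ, F.target_eq χ hχ, ?_, fun y hy hyU => hu χ hχ y hy hyU (hs hy),
        fun χ' hχ' y hy hy' _ => F.sameLevelGerm hχ hχ' hy hy'⟩, hxχ⟩
      rintro y hy (h | h)
      exacts [F.source_subset χ hχ hy h, hs hy (hPC h)]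
  have hgerm : ∀ χ ∈ 𝒜, ∀ χ' ∈ 𝒜, ∀ x ∈ χ.source, x ∈ χ'.source →
      SameLevelGerm (lastCoord χ) (lastCoord χ') x := by
    rintro χ ⟨-, -, hs, h1, h2⟩ χ' ⟨-, -, -, h1', h2'⟩ x hx hx'
    by_cases hxU : x ∈ U
    · exact (h1 x hx hxU).trans (h1' x hx' hxU).symm
    · obtain ⟨χ₁, hχ₁, hxχ₁⟩ := F.cover x fun h => hs hx (.inl h)
      exact (h2 χ₁ hχ₁ x hx hxχ₁ fun h => hxU (hCU h)).trans
        (h2' χ₁ hχ₁ x hx' hxχ₁ fun h => hxU (hCU h)).symm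
  refine ⟨{
    sing := F.sing ∪ P
    charts := 𝒜
    isDiscrete_sing := hPd
    smooth := fun χ hχ => hχ.1
    target_eq := fun χ hχ => hχ.2.1
    source_subset := fun χ hχ => hχ.2.2.1
    cover := hcover
    compatible := fun χ hχ χ' hχ' x hx => (hgerm χ hχ χ' hχ' x hx.1 hx.2).1
    maximal := ?_ }, rfl, ?_, fun χ hχ => hχ.2.2.2.1⟩
  · intro χ hχ ht hs hcompat
    have hloc : ∀ x ∈ χ.source, ∃ χ' ∈ 𝒜, x ∈ χ'.source ∧
        SameLevelGerm (lastCoord χ) (lastCoord χ') x := by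
      intro x hx
      obtain ⟨χ', hχ', hxχ'⟩ := hcover x (hs hx)
      exact ⟨χ', hχ', hxχ',
        (hcompat χ' hχ').1.sameLevelGerm (hcompat χ' hχ').2 hx hxχ'⟩
    refine ⟨hχ, ht, hs, fun x hx hxU => ?_, fun χ₁ hχ₁ x hx hx₁ hxC => ?_⟩
    · obtain ⟨χ', hχ', hxχ', hg⟩ := hloc x hx
      exact hg.trans (hχ'.2.2.2.1 x hxχ' hxU)
    · obtain ⟨χ', hχ', hxχ', hg⟩ := hloc x hx
      exact hg.trans (hχ'.2.2.2.2 χ₁ hχ₁ x hxχ' hx₁ hxC)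
  · intro χ hχC
    constructor
    · rintro ⟨hχ, ht, hs, -, h2⟩
      refine F.mem_charts_of_sameLevelGerm hχ ht (fun x hx h => hs hx (.inl h)) fun x hx => ?_
      obtain ⟨χ₁, hχ₁, hxχ₁⟩ := F.cover x fun h => hs hx (.inl h)
      exact ⟨χ₁, hχ₁, hxχ₁, h2 χ₁ hχ₁ x hx hxχ₁ (hχC hx)⟩
    · intro hχ
      refine ⟨F.smooth χ hχ, F.target_eq χ hχ, ?_, fun y hy hyU => hu χ hχ y hy hyU (hχC hy),
        fun χ' hχ' y hy hy' _ => F.sameLevelGerm hχ hχ' hy hy'⟩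
      rintro y hy (h | h)
      exacts [F.source_subset χ hχ hy h, hχC hy (hPC h)]

end SingFoliation

/-! ### Submersions -/

/-- A smooth function without critical point at `z` is, near `z`, the last coordinate of a smooth
chart. -/
theorem exists_chart_last_eq {g : RSp m → ℝ} (hg : ContDiff ℝ ∞ g) {z : RSp m}
    (hz : gradient g z ≠ 0) :
    ∃ e ∈ contDiffGroupoid ∞ (𝓡 (m + 1)), z ∈ e.source ∧ ∀ y, e y (Fin.last m) = g y := by
  set b : RSp m := EuclideanSpace.single (Fin.last m) 1
  have hb : b ≠ 0 := by simp [b]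
  obtain ⟨B, hB⟩ := SeparatingDual.exists_continuousLinearEquiv_apply_eq (R := ℝ) hb hz
  set A' : RSp m →L[ℝ] RSp m := ContinuousLinearMap.adjoint (B : RSp m →L[ℝ] RSp m)
  have hA' : ∀ v w, inner ℝ (A' v) w = inner ℝ v (B w) := fun v w =>
    ContinuousLinearMap.adjoint_inner_left _ _ _
  have hlast : ∀ v : RSp m, v (Fin.last m) = inner ℝ v b := by
    intro v
    simp [b, EuclideanSpace.inner_single_right]
  have hinj : Function.Injective A' := by
    rw [injective_iff_map_eq_zero]
    intro v hv
    have := hA' v (B.symm v)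
    rw [hv, inner_zero_left, B.apply_symm_apply] at this
    exact inner_self_eq_zero.1 this.symm
  let A : RSp m ≃L[ℝ] RSp m :=
    (LinearEquiv.ofInjectiveEndo (A' : RSp m →ₗ[ℝ] RSp m) hinj).toContinuousLinearEquiv
  have hA : ∀ v, A v = A' v := fun v => rfl
  have hgrad : ∀ v, inner ℝ (gradient g z) v = fderiv ℝ g z v := fun v => by
    simp [gradient]
  -- in its last coordinate, the linear map `A` is the differential of `g` at `z`
  have hAlast : ∀ v, A v (Fin.last m) = fderiv ℝ g z v := by
    intro v
    rw [hlast, hA, hA', hB, real_inner_comm, hgrad]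
  let G : RSp m → RSp m := fun y => A y + (g y - fderiv ℝ g z y) • b
  have hG : ContDiff ℝ ∞ G := by
    have := A.contDiff (n := ∞)
    have := (fderiv ℝ g z).contDiff (n := ∞)
    fun_prop
  have hGlast : ∀ y, G y (Fin.last m) = g y := by
    intro y
    simp [G, hAlast, b]
  have hGz : HasFDerivAt G (A : RSp m →L[ℝ] RSp m) z := by
    have h1 : HasFDerivAt (fun y => g y - fderiv ℝ g z y) (fderiv ℝ g z - fderiv ℝ g z) z :=
      (hg.differentiable (by simp) z).hasFDerivAt.sub (fderiv ℝ g z).hasFDerivAt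
    have h2 : HasFDerivAt G _ z := A.hasFDerivAt.add (h1.smul_const b)
    refine h2.congr_fderiv ?_
    ext v
    simp
  let e₀ := hG.contDiffAt.toOpenPartialHomeomorph G hGz (by simp)
  have hopen : IsOpen {y | ∃ L : RSp m ≃L[ℝ] RSp m, (L : RSp m →L[ℝ] RSp m) = fderiv ℝ G y} := by
    have : IsOpen (Set.range ((↑) : (RSp m ≃L[ℝ] RSp m) → RSp m →L[ℝ] RSp m)) :=
      ContinuousLinearEquiv.isOpen
    exact this.preimage (hG.continuous_fderiv (by simp))
  have hz₀ : z ∈ e₀.source := hG.contDiffAt.mem_toOpenPartialHomeomorph_source hGz (by simp)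
  refine ⟨e₀.restrOpen _ hopen, mem_contDiffGroupoid_of_contDiffOn hG.contDiffOn ?_,
    ⟨hz₀, A, hGz.fderiv.symm⟩, hGlast⟩
  intro y hy
  obtain ⟨L, hL⟩ := ((e₀.restrOpen _ hopen).map_target hy).2
  refine (OpenPartialHomeomorph.contDiffAt_symm _ (f₀' := L) hy ?_ hG.contDiffAt).contDiffWithinAt
  rw [hL]
  exact (hG.differentiable (by simp) _).hasFDerivAt

end

section

variable {m : ℕ}

/-! ### Non-degenerate critical points -/

theorem IsNondegCriticalPoint.congr {f g : RSp m → ℝ} {a : RSp m} {l : ℕ}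
    (h : IsNondegCriticalPoint f a l) (hfg : g =ᶠ[𝓝 a] f) : IsNondegCriticalPoint g a l := by
  rw [IsNondegCriticalPoint, hfg.fderiv_eq, hfg.fderiv.fderiv_eq]
  exact h

/-- Non-degeneracy and index of a critical point do not depend on the coordinates. -/
theorem IsNondegCriticalPoint.comp {g : RSp m → ℝ} {τ : RSp m → RSp m} {a : RSp m} {l : ℕ}
    (h : IsNondegCriticalPoint g (τ a) l) (hg : ContDiffAt ℝ ∞ g (τ a)) (hτ : ContDiffAt ℝ ∞ τ a)
    (L : RSp m ≃L[ℝ] RSp m) (hL : fderiv ℝ τ a = L) : IsNondegCriticalPoint (g ∘ τ) a l := by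
  obtain ⟨h0, hnd, hidx⟩ := h
  have hg1 : ∀ᶠ y in 𝓝 a, DifferentiableAt ℝ g (τ y) :=
    hτ.continuousAt.eventually ((hg.of_le (m := 1) (by simp)).eventually (by simp) |>.mono
      fun y hy => hy.differentiableAt (by simp))
  have hτ1 : ∀ᶠ y in 𝓝 a, DifferentiableAt ℝ τ y :=
    ((hτ.of_le (m := 1) (by simp)).eventually (by simp)).mono fun y hy =>
      hy.differentiableAt (by simp)
  have hfd : fderiv ℝ (g ∘ τ) =ᶠ[𝓝 a] fun y => (fderiv ℝ g (τ y)).comp (fderiv ℝ τ y) := by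
    filter_upwards [hg1, hτ1] with y h1 h2
    exact fderiv_comp y h1 h2
  have hdg : DifferentiableAt ℝ (fderiv ℝ g) (τ a) :=
    (hg.fderiv_right (m := 1) (by norm_cast)).differentiableAt (by simp)
  have hdτ : DifferentiableAt ℝ (fderiv ℝ τ) a :=
    (hτ.fderiv_right (m := 1) (by norm_cast)).differentiableAt (by simp)
  have hH : ∀ v w, fderiv ℝ (fderiv ℝ (g ∘ τ)) a v w
      = fderiv ℝ (fderiv ℝ g) (τ a) (L v) (L w) := by
    intro v w
    have h1 : HasFDerivAt (fun y => fderiv ℝ g (τ y)) _ a :=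
      hdg.hasFDerivAt.comp a hτ1.self_of_nhds.hasFDerivAt
    rw [hfd.fderiv_eq, (h1.clm_comp hdτ.hasFDerivAt).fderiv]
    simp [h0, hL]
  refine ⟨?_, ?_, ?_⟩
  · rw [hfd.self_of_nhds]
    simp [h0]
  · intro v hv
    rw [← L.map_eq_zero_iff]
    refine hnd _ fun w => ?_
    rw [← L.apply_symm_apply w, ← hH]
    exact hv _
  · convert hidx using 1
    ext d
    constructor
    · rintro ⟨V, hV, hneg⟩
      refine ⟨V.map (L : RSp m →ₗ[ℝ] RSp m), ?_, ?_⟩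
      · rw [← hV]
        exact LinearEquiv.finrank_map_eq L.toLinearEquiv V
      · rintro _ ⟨v, hv, rfl⟩ hv0
        have := hneg v hv (by rintro rfl; simp at hv0)
        rwa [hH] at this
    · rintro ⟨V, hV, hneg⟩
      refine ⟨V.map (L.symm : RSp m →ₗ[ℝ] RSp m), ?_, ?_⟩
      · rw [← hV]
        exact LinearEquiv.finrank_map_eq L.symm.toLinearEquiv V
      · rintro _ ⟨v, hv, rfl⟩ hv0
        have := hneg v hv (by rintro rfl; simp at hv0)
        rw [hH]
        simpa using this

/-- The index of a critical point with diagonal Hessian is the number of negative entries. -/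
theorem isNondegCriticalPoint_of_diagonal {g : RSp m → ℝ} {a : RSp m} (d : Fin (m + 1) → ℝ)
    (h0 : fderiv ℝ g a = 0)
    (h2 : ∀ v w, fderiv ℝ (fderiv ℝ g) a v w = ∑ i, d i * v i * w i) (hd : ∀ i, d i ≠ 0) :
    IsNondegCriticalPoint g a (Finset.univ.filter fun i => d i < 0).card := by
  refine ⟨h0, ?_, ?_, ?_⟩
  · intro v hv
    ext i
    have := hv (EuclideanSpace.single i 1)
    rw [h2] at this
    simpa [hd i] using this
  · let N := {i : Fin (m + 1) // d i < 0}
    let ι : (N → ℝ) →ₗ[ℝ] RSp m :=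
      { toFun := fun c => WithLp.toLp 2 fun i => if h : d i < 0 then c ⟨i, h⟩ else 0
        map_add' := fun c c' => by
          ext i
          by_cases h : d i < 0 <;> simp [h]
        map_smul' := fun t c => by
          ext i
          by_cases h : d i < 0 <;> simp [h] }
    have hι : ∀ c i, ι c i = if h : d i < 0 then c ⟨i, h⟩ else 0 := fun c i => rfl
    refine ⟨LinearMap.range ι, ?_, ?_⟩
    · rw [LinearMap.finrank_range_of_inj, Module.finrank_fintype_fun_eq_card, Fintype.card_subtype]
      intro c c' h
      ext ⟨i, hi⟩
      have := congrArg (fun v : RSp m => v i) h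
      simpa [hι, hi] using this
    · rintro _ ⟨c, rfl⟩ hc
      rw [h2]
      have hle : ∀ i, d i * ι c i * ι c i ≤ 0 := by
        intro i
        by_cases h : d i < 0
        · rw [mul_assoc]
          exact mul_nonpos_of_nonpos_of_nonneg h.le (mul_self_nonneg _)
        · simp [hι, h]
      obtain ⟨i, hi⟩ : ∃ i, ι c i ≠ 0 := by
        by_contra! h
        exact hc (by ext i; exact h i)
      have hdi : d i < 0 := by
        by_contra h
        exact hi (by simp [hι, h])
      refine (Finset.sum_neg' (fun i _ => hle i) ⟨i, Finset.mem_univ i, ?_⟩)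
      rw [mul_assoc]
      exact mul_neg_of_neg_of_pos hdi (mul_self_pos.2 hi)
  · rintro e ⟨V, rfl, hV⟩
    let N := {i : Fin (m + 1) // d i < 0}
    let π : V →ₗ[ℝ] (N → ℝ) :=
      { toFun := fun v i => (v : RSp m) i
        map_add' := fun v w => rfl
        map_smul' := fun t v => rfl }
    have hinj : Function.Injective π := by
      rw [injective_iff_map_eq_zero]
      intro v hv
      by_contra hne
      have hlt := hV v v.2 (by simpa using hne)
      rw [h2] at hlt
      refine absurd hlt (not_lt.2 (Finset.sum_nonneg fun i _ => ?_))
      by_cases h : d i < 0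
      · have : (v : RSp m) i = 0 := congrFun hv ⟨i, h⟩
        simp [this]
      · rw [mul_assoc]
        exact mul_nonneg (not_lt.1 h) (mul_self_nonneg _)
    have := LinearMap.finrank_le_finrank_of_injective hinj
    rwa [Module.finrank_fintype_fun_eq_card, Fintype.card_subtype] at this

/-! ### Sums of functions of one coordinate -/

theorem hasFDerivAt_sum_coord {ι : Type*} [Fintype ι] {h h' : ι → ℝ → ℝ} {x : EuclideanSpace ℝ ι}
    (hh : ∀ i, HasDerivAt (h i) (h' i (x i)) (x i)) :
    HasFDerivAt (fun y : EuclideanSpace ℝ ι => ∑ i, h i (y i))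
      (∑ i, h' i (x i) • (EuclideanSpace.proj i : EuclideanSpace ℝ ι →L[ℝ] ℝ)) x := by
  refine HasFDerivAt.fun_sum fun i _ => ?_
  exact (hh i).comp_hasFDerivAt x (EuclideanSpace.proj i : EuclideanSpace ℝ ι →L[ℝ] ℝ).hasFDerivAt

theorem sum_smul_proj_single {ι : Type*} [Fintype ι] [DecidableEq ι] (w : ι → ℝ) (i : ι) :
    (∑ j, w j • (EuclideanSpace.proj j : EuclideanSpace ℝ ι →L[ℝ] ℝ)) (EuclideanSpace.single i 1)
      = w i := by
  simp

theorem gradient_apply_eq_fderiv {ι : Type*} [Fintype ι] [DecidableEq ι]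
    (f : EuclideanSpace ℝ ι → ℝ) (x : EuclideanSpace ℝ ι) (i : ι) :
    gradient f x i = fderiv ℝ f x (EuclideanSpace.single i 1) := by
  have h : gradient f x i = inner ℝ (gradient f x) (EuclideanSpace.single i 1) := by
    rw [EuclideanSpace.inner_single_right]
    simp
  rw [h, gradient, InnerProductSpace.toDual_symm_apply]

/-! ### The model functions -/

/-- The sign of the square of the coordinate `i ≠ k` in the model functions. -/
def modelSign (k i : Fin (m + 1)) : ℝ := if i < k then -1 else 1

theorem modelSign_sq (k i : Fin (m + 1)) : modelSign k i ^ 2 = 1 := by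
  unfold modelSign
  split_ifs <;> norm_num

/-- The contribution of the coordinate `i` to the model function. -/
def modelTerm (k : Fin (m + 1)) (ε : ℝ) (i : Fin (m + 1)) (s : ℝ) : ℝ :=
  if i = k then s ^ 3 / 3 - ε * s else modelSign k i * (s ^ 2 / 2)

/-- The derivative of `modelTerm`. -/
def modelTermDeriv (k : Fin (m + 1)) (ε : ℝ) (i : Fin (m + 1)) (s : ℝ) : ℝ :=
  if i = k then s ^ 2 - ε else modelSign k i * s

theorem modelFn_eq_sum (k : Fin (m + 1)) (ε : ℝ) (x : RSp m) :
    modelFn k ε x = ∑ i, modelTerm k ε i (x i) := by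
  have h1 : ∑ i ∈ Finset.Iio k, x i ^ 2 / 2 = ∑ i, if i < k then x i ^ 2 / 2 else 0 := by
    rw [← Finset.sum_filter]
    congr 1
    ext i
    simp
  have h2 : ∑ i ∈ Finset.Ioi k, x i ^ 2 / 2 = ∑ i, if k < i then x i ^ 2 / 2 else 0 := by
    rw [← Finset.sum_filter]
    congr 1
    ext i
    simp
  have h3 : x k ^ 3 / 3 - ε * x k = ∑ i, if i = k then x i ^ 3 / 3 - ε * x i else 0 := by
    simp
  rw [modelFn, h1, h2, h3, ← Finset.sum_neg_distrib, ← Finset.sum_add_distrib,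
    ← Finset.sum_add_distrib]
  refine Finset.sum_congr rfl fun i _ => ?_
  rcases lt_trichotomy i k with h | rfl | h
  · simp [modelTerm, modelSign, h, h.ne, h.not_gt]
  · simp [modelTerm]
  · simp [modelTerm, modelSign, h, h.ne', h.not_gt]

theorem contDiff_modelFn (k : Fin (m + 1)) (ε : ℝ) : ContDiff ℝ ∞ (modelFn k ε) := by
  unfold modelFn
  fun_prop

theorem hasDerivAt_modelTerm (k : Fin (m + 1)) (ε : ℝ) (i : Fin (m + 1)) (s : ℝ) :
    HasDerivAt (modelTerm k ε i) (modelTermDeriv k ε i s) s := by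
  unfold modelTerm modelTermDeriv
  split_ifs
  · have := ((hasDerivAt_pow 3 s).div_const 3).sub ((hasDerivAt_id s).const_mul ε)
    refine this.congr_deriv ?_
    norm_num
  · have := ((hasDerivAt_pow 2 s).div_const 2).const_mul (modelSign k i)
    refine this.congr_deriv ?_
    norm_num

theorem hasFDerivAt_modelFn (k : Fin (m + 1)) (ε : ℝ) (x : RSp m) :
    HasFDerivAt (modelFn k ε)
      (∑ i, modelTermDeriv k ε i (x i) • (EuclideanSpace.proj i : RSp m →L[ℝ] ℝ)) x := by
  rw [funext (modelFn_eq_sum k ε)]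
  exact hasFDerivAt_sum_coord fun i => hasDerivAt_modelTerm k ε i (x i)

theorem gradient_modelFn (k : Fin (m + 1)) (ε : ℝ) (x : RSp m) (i : Fin (m + 1)) :
    gradient (modelFn k ε) x i = modelTermDeriv k ε i (x i) := by
  rw [gradient_apply_eq_fderiv, (hasFDerivAt_modelFn k ε x).fderiv,
    sum_smul_proj_single fun i => modelTermDeriv k ε i (x i)]

theorem isNondegCriticalPoint_modelFn (k : Fin (m + 1)) {ε s : ℝ} (hs : s ^ 2 = ε) (hs0 : s ≠ 0) :
    IsNondegCriticalPoint (modelFn k ε) (EuclideanSpace.single k s)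
      (Finset.univ.filter fun i => (if i = k then 2 * s else modelSign k i) < 0).card := by
  apply isNondegCriticalPoint_of_diagonal
  · rw [(hasFDerivAt_modelFn k ε _).fderiv]
    refine Finset.sum_eq_zero fun i _ => ?_
    have : modelTermDeriv k ε i ((EuclideanSpace.single k s : RSp m) i) = 0 := by
      by_cases h : i = k
      · subst h; simp [modelTermDeriv, hs]
      · simp [modelTermDeriv, h]
    rw [this, zero_smul]
  · intro v w
    have hfd : fderiv ℝ (modelFn k ε) = fun x : RSp m =>
        ∑ i, modelTermDeriv k ε i (x i) • (EuclideanSpace.proj i : RSp m →L[ℝ] ℝ) :=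
      funext fun x => (hasFDerivAt_modelFn k ε x).fderiv
    have hterm : ∀ i t, HasDerivAt (modelTermDeriv k ε i)
        (if i = k then 2 * t else modelSign k i) t := by
      intro i t
      unfold modelTermDeriv
      split_ifs
      · simpa using (hasDerivAt_pow 2 t).sub_const ε
      · simpa using (hasDerivAt_id t).const_mul (modelSign k i)
    have h2 := HasFDerivAt.fun_sum (u := Finset.univ) (x := (EuclideanSpace.single k s : RSp m))
      fun i _ => (((hterm i _).comp_hasFDerivAt (EuclideanSpace.single k s : RSp m)
        (EuclideanSpace.proj i : RSp m →L[ℝ] ℝ).hasFDerivAt).smul_const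
        (EuclideanSpace.proj i : RSp m →L[ℝ] ℝ))
    rw [hfd]
    change fderiv ℝ (fun y : RSp m => ∑ i,
      (modelTermDeriv k ε i ∘ (EuclideanSpace.proj i : RSp m →L[ℝ] ℝ)) y •
        (EuclideanSpace.proj i : RSp m →L[ℝ] ℝ)) _ v w = _
    rw [h2.fderiv]
    simp only [sum_apply, ContinuousLinearMap.smulRight_apply, smul_apply, smul_eq_mul,
      PiLp.proj_apply]
    refine Finset.sum_congr rfl fun i _ => ?_
    by_cases h : i = k
    · subst h; simp
    · simp [h]
  · intro i
    split_ifs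
    · simpa using hs0
    · intro h
      simpa [h] using modelSign_sq k i

theorem isNondegCriticalPoint_modelFn_neg (k : Fin (m + 1)) {s : ℝ} (hs : s < 0) :
    IsNondegCriticalPoint (modelFn k (s ^ 2)) (EuclideanSpace.single k s) (k + 1) := by
  have hcard : (Finset.univ.filter fun i => (if i = k then 2 * s else modelSign k i) < 0)
      = Finset.Iic k := by
    ext i
    rw [Finset.mem_filter, Finset.mem_Iic, modelSign]
    split_ifs with h h'
    · simp only [Finset.mem_univ, true_and, h, le_refl, iff_true]
      linarith
    · simp [h'.le]
    · norm_num
      exact lt_of_le_of_ne (not_lt.1 h') (Ne.symm h)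
  rw [← Fin.card_Iic, ← hcard]
  exact isNondegCriticalPoint_modelFn k rfl hs.ne

theorem isNondegCriticalPoint_modelFn_pos (k : Fin (m + 1)) {s : ℝ} (hs : 0 < s) :
    IsNondegCriticalPoint (modelFn k (s ^ 2)) (EuclideanSpace.single k s) k := by
  have hcard : (Finset.univ.filter fun i => (if i = k then 2 * s else modelSign k i) < 0)
      = Finset.Iio k := by
    ext i
    rw [Finset.mem_filter, Finset.mem_Iio, modelSign]
    split_ifs with h h'
    · simp [h, hs.le]
    · simp [h']
    · norm_num
      exact not_lt.1 h'
  rw [← Fin.card_Iio, ← hcard]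
  exact isNondegCriticalPoint_modelFn k rfl hs.ne'

end

section

variable {m : ℕ}

/-! ### The function with a pair of critical points -/

theorem exists_abs_deriv_smoothTransition_le :
    ∃ C, 0 < C ∧ ∀ x, |deriv Real.smoothTransition x| ≤ C := by
  have hc : Continuous (deriv Real.smoothTransition) :=
    (Real.smoothTransition.contDiff (n := 1)).continuous_deriv (by simp)
  obtain ⟨C, hC⟩ := isCompact_Icc.exists_bound_of_continuousOn (s := Set.Icc (0 : ℝ) 1)
    hc.continuousOn
  refine ⟨max C 1, by positivity, fun x => ?_⟩
  by_cases hx : x ∈ Set.Icc (0 : ℝ) 1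
  · exact (hC x hx).trans (le_max_left _ _)
  · have h0 : deriv Real.smoothTransition x = 0 := by
      rcases lt_or_ge x 0 with h | h
      · have : Real.smoothTransition =ᶠ[𝓝 x] fun _ => 0 :=
          Filter.eventually_of_mem (Iio_mem_nhds h) fun y hy =>
            Real.smoothTransition.zero_of_nonpos (le_of_lt hy)
        rw [this.deriv_eq, deriv_const]
      · have : Real.smoothTransition =ᶠ[𝓝 x] fun _ => 1 :=
          Filter.eventually_of_mem (Ioi_mem_nhds (not_le.1 fun h' => hx ⟨h, h'⟩)) fun y hy =>
            Real.smoothTransition.one_of_one_le (le_of_lt hy)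
        rw [this.deriv_eq, deriv_const]
    rw [h0, abs_zero]
    positivity

theorem deriv_smoothTransition_of_one_lt {x : ℝ} (h : 1 < x) :
    deriv Real.smoothTransition x = 0 := by
  have : Real.smoothTransition =ᶠ[𝓝 x] fun _ => 1 :=
    Filter.eventually_of_mem (Ioi_mem_nhds h) fun y hy =>
      Real.smoothTransition.one_of_one_le (le_of_lt hy)
  rw [this.deriv_eq, deriv_const]

/-- The square of the distance to the axis of the coordinate `k`. -/
def transSq (k : Fin (m + 1)) (x : RSp m) : ℝ := ∑ i, if i = k then 0 else x i ^ 2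

/-- An odd function that is the identity near `[-1, 1]` and has compact support. -/
def cutId (s : ℝ) : ℝ := Real.smoothTransition (3 - s ^ 2) * s

/-- The interpolation between the model function with parameter `1`, near the segment between its
critical points, and the model function with parameter `-1`, far away. The parameter `lam` is the
inverse of the square of the transverse scale. -/
def saddlePairFn (k : Fin (m + 1)) (lam : ℝ) (x : RSp m) : ℝ :=
  modelFn k (-1) x - 2 * (Real.smoothTransition (2 - lam * transSq k x) * cutId (x k))

/-- The relative change of the transverse components of the gradient that the interpolation
causes. -/
def twist (k : Fin (m + 1)) (lam : ℝ) (x : RSp m) : ℝ :=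
  4 * lam * deriv Real.smoothTransition (2 - lam * transSq k x) * cutId (x k)

/-- The set off which `saddlePairFn` is the model function without critical points. -/
def saddlePairSupport (k : Fin (m + 1)) (lam : ℝ) : Set (RSp m) :=
  {x | lam * transSq k x ≤ 2 ∧ x k ^ 2 ≤ 3}

theorem transSq_eq_zero {k : Fin (m + 1)} {x : RSp m} (h : ∀ i ≠ k, x i = 0) :
    transSq k x = 0 :=
  Finset.sum_eq_zero fun i _ => by
    split_ifs with hi
    · rfl
    · rw [h i hi]; norm_num

theorem contDiff_transSq (k : Fin (m + 1)) : ContDiff ℝ ∞ (transSq k) := by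
  unfold transSq
  refine ContDiff.sum fun i _ => ?_
  split_ifs <;> fun_prop

theorem contDiff_cutId : ContDiff ℝ ∞ cutId := by
  unfold cutId
  exact (Real.smoothTransition.contDiff.comp (by fun_prop)).mul contDiff_id

theorem contDiff_saddlePairFn (k : Fin (m + 1)) (lam : ℝ) : ContDiff ℝ ∞ (saddlePairFn k lam) := by
  unfold saddlePairFn
  have h1 : ContDiff ℝ ∞ fun x : RSp m => Real.smoothTransition (2 - lam * transSq k x) :=
    Real.smoothTransition.contDiff.comp
      (contDiff_const.sub (contDiff_const.mul (contDiff_transSq k)))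
  have h2 : ContDiff ℝ ∞ fun x : RSp m => cutId (x k) := contDiff_cutId.comp (by fun_prop)
  exact (contDiff_modelFn k (-1)).sub (contDiff_const.mul (h1.mul h2))

theorem isCompact_saddlePairSupport (k : Fin (m + 1)) {lam : ℝ} (hlam : 0 < lam) :
    IsCompact (saddlePairSupport k lam) := by
  refine Metric.isCompact_of_isClosed_isBounded ?_ ?_
  · have h1 : Continuous fun x : RSp m => lam * transSq k x :=
      continuous_const.mul (contDiff_transSq k).continuous
    have h2 : Continuous fun x : RSp m => x k ^ 2 := by fun_prop
    exact (isClosed_le h1 continuous_const).inter (isClosed_le h2 continuous_const)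
  · refine (Metric.isBounded_closedBall (x := (0 : RSp m)) (r := √(2 / lam + 3))).subset ?_
    rintro x ⟨h1, h2⟩
    rw [mem_closedBall_zero_iff, EuclideanSpace.norm_eq]
    apply Real.sqrt_le_sqrt
    have h3 : transSq k x ≤ 2 / lam := by
      rw [le_div_iff₀ hlam]; linarith
    have h4 : ∑ i, ‖x i‖ ^ 2 = transSq k x + x k ^ 2 := by
      have : x k ^ 2 = ∑ i, if i = k then x i ^ 2 else 0 := by simp
      rw [this, transSq, ← Finset.sum_add_distrib]
      refine Finset.sum_congr rfl fun i _ => ?_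
      rw [Real.norm_eq_abs, sq_abs]
      split_ifs <;> simp
    linarith

theorem saddlePairFn_of_notMem {k : Fin (m + 1)} {lam : ℝ} {x : RSp m}
    (h : x ∉ saddlePairSupport k lam) : saddlePairFn k lam x = modelFn k (-1) x := by
  rw [saddlePairFn, cutId]
  by_cases h1 : lam * transSq k x ≤ 2
  · have h2 : ¬ x k ^ 2 ≤ 3 := fun h2 => h ⟨h1, h2⟩
    rw [Real.smoothTransition.zero_of_nonpos (x := 3 - x k ^ 2) (by linarith)]
    ring
  · rw [Real.smoothTransition.zero_of_nonpos (x := 2 - lam * transSq k x) (by linarith)]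
    ring

theorem saddlePairFn_of_le {k : Fin (m + 1)} {lam : ℝ} {x : RSp m} (h1 : lam * transSq k x ≤ 1)
    (h2 : x k ^ 2 ≤ 2) : saddlePairFn k lam x = modelFn k 1 x := by
  rw [saddlePairFn, cutId, Real.smoothTransition.one_of_one_le (x := 3 - x k ^ 2) (by linarith),
    Real.smoothTransition.one_of_one_le (x := 2 - lam * transSq k x) (by linarith)]
  unfold modelFn
  ring

/-- The open neighbourhood of the segment between the critical points where `saddlePairFn` is the
model function with parameter `1`. -/
def saddlePairCore (k : Fin (m + 1)) (lam : ℝ) : Set (RSp m) :=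
  {x | lam * transSq k x < 1 ∧ x k ^ 2 < 2}

theorem isOpen_saddlePairCore (k : Fin (m + 1)) (lam : ℝ) : IsOpen (saddlePairCore k lam) := by
  have h1 : Continuous fun x : RSp m => lam * transSq k x :=
    continuous_const.mul (contDiff_transSq k).continuous
  have h2 : Continuous fun x : RSp m => x k ^ 2 := by fun_prop
  exact (isOpen_lt h1 continuous_const).inter (isOpen_lt h2 continuous_const)

theorem saddlePairFn_eventuallyEq {k : Fin (m + 1)} {lam : ℝ} {x : RSp m}
    (hx : x ∈ saddlePairCore k lam) : saddlePairFn k lam =ᶠ[𝓝 x] modelFn k 1 :=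
  Filter.eventually_of_mem ((isOpen_saddlePairCore k lam).mem_nhds hx) fun _ hy =>
    saddlePairFn_of_le hy.1.le hy.2.le

theorem saddlePairCore_subset (k : Fin (m + 1)) (lam : ℝ) :
    saddlePairCore k lam ⊆ saddlePairSupport k lam := by
  rintro x ⟨h1, h2⟩
  constructor <;> linarith

theorem hasDerivAt_cutId (s : ℝ) : HasDerivAt cutId (Real.smoothTransition (3 - s ^ 2)
    - 2 * s ^ 2 * deriv Real.smoothTransition (3 - s ^ 2)) s := by
  have h1 : HasDerivAt (fun s : ℝ => 3 - s ^ 2) (-(2 * s)) s := by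
    simpa using (hasDerivAt_pow 2 s).const_sub 3
  have h2 : HasDerivAt Real.smoothTransition (deriv Real.smoothTransition (3 - s ^ 2))
      (3 - s ^ 2) :=
    ((Real.smoothTransition.contDiff (n := 1)).differentiable (by simp) _).hasDerivAt
  refine ((h2.comp s h1).mul (hasDerivAt_id s)).congr_deriv ?_
  simp
  ring

theorem abs_cutId_le (s : ℝ) : |cutId s| ≤ 2 := by
  rw [cutId, abs_mul, abs_of_nonneg (Real.smoothTransition.nonneg _)]
  rcases le_or_gt (s ^ 2) 3 with h | h
  · have h1 : |s| ≤ 2 := abs_le_of_sq_le_sq (by linarith) (by norm_num)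
    nlinarith [Real.smoothTransition.nonneg (3 - s ^ 2), Real.smoothTransition.le_one (3 - s ^ 2),
      abs_nonneg s]
  · rw [Real.smoothTransition.zero_of_nonpos (by linarith)]
    norm_num

/-- If the transverse scale is large, the interpolation does not change the signs of the transverse
components of the gradient. -/
theorem exists_abs_twist_lt_one : ∃ lam : ℝ, 0 < lam ∧
    ∀ (k : Fin (m + 1)) (x : RSp m), |twist k lam x| < 1 := by
  obtain ⟨C, hC, hle⟩ := exists_abs_deriv_smoothTransition_le
  refine ⟨1 / (16 * C), by positivity, fun k x => ?_⟩
  have h1 := hle (2 - 1 / (16 * C) * transSq k x)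
  have h2 := abs_cutId_le (x k)
  rw [twist, abs_mul, abs_mul, abs_of_pos (by positivity : (0 : ℝ) < 4 * (1 / (16 * C)))]
  calc _ ≤ 4 * (1 / (16 * C)) * C * 2 := by gcongr
    _ < 1 := by field_simp; norm_num

theorem hasFDerivAt_transSq (k : Fin (m + 1)) (x : RSp m) :
    HasFDerivAt (transSq k)
      (∑ i, (if i = k then 0 else 2 * x i) • (EuclideanSpace.proj i : RSp m →L[ℝ] ℝ)) x := by
  refine hasFDerivAt_sum_coord (h := fun i s => if i = k then 0 else s ^ 2)
    (h' := fun i s => if i = k then 0 else 2 * s) fun i => ?_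
  split_ifs
  · exact hasDerivAt_const _ _
  · simpa using hasDerivAt_pow 2 (x i)

theorem gradient_saddlePairFn (k : Fin (m + 1)) (lam : ℝ) (x : RSp m) (i : Fin (m + 1)) :
    gradient (saddlePairFn k lam) x i = modelTermDeriv k (-1) i (x i)
      - 2 * (Real.smoothTransition (2 - lam * transSq k x)
          * ((Real.smoothTransition (3 - x k ^ 2)
            - 2 * x k ^ 2 * deriv Real.smoothTransition (3 - x k ^ 2)) * if i = k then 1 else 0)
        + cutId (x k) * (deriv Real.smoothTransition (2 - lam * transSq k x)
            * -(lam * if i = k then 0 else 2 * x i))) := by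
  have h1 : HasFDerivAt (fun x : RSp m => 2 - lam * transSq k x) _ x :=
    ((hasFDerivAt_transSq k x).const_mul lam).const_sub 2
  have h2 : HasDerivAt Real.smoothTransition
      (deriv Real.smoothTransition (2 - lam * transSq k x)) (2 - lam * transSq k x) :=
    ((Real.smoothTransition.contDiff (n := 1)).differentiable (by simp) _).hasDerivAt
  have h3 := (hasDerivAt_cutId (x k)).comp_hasFDerivAt x
    (EuclideanSpace.proj k : RSp m →L[ℝ] ℝ).hasFDerivAt
  have h4 := (hasFDerivAt_modelFn k (-1) x).sub (((h2.comp_hasFDerivAt x h1).mul h3).const_mul 2)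
  have h5 : fderiv ℝ (saddlePairFn k lam) x = _ := h4.fderiv
  rw [gradient_apply_eq_fderiv, h5]
  simp only [sub_apply, add_apply, smul_apply, neg_apply, smul_eq_mul, Function.comp_apply]
  rw [sum_smul_proj_single fun i => modelTermDeriv k (-1) i (x i),
    sum_smul_proj_single fun i => if i = k then 0 else 2 * x i]
  simp [eq_comm]

theorem gradient_saddlePairFn_of_ne {k i : Fin (m + 1)} (h : i ≠ k) (lam : ℝ) (x : RSp m) :
    gradient (saddlePairFn k lam) x i = (modelSign k i + twist k lam x) * x i := by
  rw [gradient_saddlePairFn, modelTermDeriv, twist]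
  simp only [h, if_false]
  ring

theorem gradient_saddlePairFn_self (k : Fin (m + 1)) (lam : ℝ) (x : RSp m) :
    gradient (saddlePairFn k lam) x k = x k ^ 2 + 1
      - 2 * (Real.smoothTransition (2 - lam * transSq k x) * (Real.smoothTransition (3 - x k ^ 2)
            - 2 * x k ^ 2 * deriv Real.smoothTransition (3 - x k ^ 2))) := by
  rw [gradient_saddlePairFn, modelTermDeriv]
  simp only [if_true]
  ring

/-- The gradient of `saddlePairFn` grows at least as fast in the direction `k` as the one of the
model function with parameter `1`. -/
theorem sq_sub_one_le_gradient_saddlePairFn (k : Fin (m + 1)) (lam : ℝ) (x : RSp m) :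
    x k ^ 2 - 1 ≤ gradient (saddlePairFn k lam) x k := by
  rw [gradient_saddlePairFn_self]
  have h1 := Real.smoothTransition.nonneg (2 - lam * transSq k x)
  have h2 := Real.smoothTransition.le_one (2 - lam * transSq k x)
  have h3 := Real.smoothTransition.le_one (3 - x k ^ 2)
  have h4 : 0 ≤ x k ^ 2 * deriv Real.smoothTransition (3 - x k ^ 2) :=
    mul_nonneg (sq_nonneg _) Real.smoothTransition.monotone.deriv_nonneg
  have h5 : Real.smoothTransition (2 - lam * transSq k x) * (Real.smoothTransition (3 - x k ^ 2)
      - 2 * (x k ^ 2 * deriv Real.smoothTransition (3 - x k ^ 2))) ≤ 1 * 1 := by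
    refine (mul_le_mul_of_nonneg_left (by linarith : _ ≤ (1 : ℝ)) h1).trans ?_
    linarith
  rw [mul_assoc]
  linarith

theorem gradient_saddlePairFn_eq_zero_iff {k : Fin (m + 1)} {lam : ℝ} {x : RSp m}
    (ht : |twist k lam x| < 1) : gradient (saddlePairFn k lam) x = 0 ↔
      x = EuclideanSpace.single k (-1) ∨ x = EuclideanSpace.single k 1 := by
  have hsplit : ∀ s : ℝ, x = EuclideanSpace.single k s ↔ (∀ i ≠ k, x i = 0) ∧ x k = s := by
    intro s
    constructor
    · rintro rfl
      exact ⟨fun i hi => by simp [hi], by simp⟩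
    · rintro ⟨h1, h2⟩
      ext i
      by_cases hi : i = k
      · subst hi; simp [h2]
      · simp [h1 i hi, hi]
  have hsq : ∀ i ≠ k, gradient (saddlePairFn k lam) x i = 0 ↔ x i = 0 := by
    intro i hi
    rw [gradient_saddlePairFn_of_ne hi, mul_eq_zero, or_iff_right]
    intro h
    have := modelSign_sq k i
    obtain ⟨h1, h2⟩ := abs_lt.1 ht
    nlinarith
  rw [hsplit, hsplit, ← and_or_left]
  constructor
  · intro h
    refine ⟨fun i hi => (hsq i hi).1 (by rw [h]; rfl), ?_⟩
    have hk : gradient (saddlePairFn k lam) x k = 0 := by rw [h]; rfl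
    have hle := (sq_sub_one_le_gradient_saddlePairFn k lam x).trans_eq hk
    have hr := transSq_eq_zero fun i hi => (hsq i hi).1 (by rw [h]; rfl)
    rw [gradient_saddlePairFn_self, hr, mul_zero,
      Real.smoothTransition.one_of_one_le (by norm_num),
      Real.smoothTransition.one_of_one_le (by linarith),
      deriv_smoothTransition_of_one_lt (by linarith)] at hk
    have : (x k + 1) * (x k - 1) = 0 := by linarith
    rcases mul_eq_zero.1 this with h | h
    · left; linarith
    · right; linarith
  · rintro ⟨h0, h1⟩
    have h2 : x k ^ 2 = 1 := by rcases h1 with h | h <;> rw [h] <;> norm_num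
    ext i
    by_cases hi : i = k
    · subst hi
      rw [gradient_saddlePairFn_self, transSq_eq_zero h0, mul_zero, h2,
        Real.smoothTransition.one_of_one_le (by norm_num),
        Real.smoothTransition.one_of_one_le (by norm_num),
        deriv_smoothTransition_of_one_lt (by norm_num)]
      norm_num
    · exact (hsq i hi).2 (h0 i hi)

theorem single_mem_saddlePairCore (k : Fin (m + 1)) (lam : ℝ) {s : ℝ} (hs : s ^ 2 < 2) :
    EuclideanSpace.single k s ∈ saddlePairCore k lam := by
  refine ⟨?_, by simpa using hs⟩
  rw [transSq_eq_zero fun i hi => by simp [hi], mul_zero]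
  exact one_pos

theorem isNondegCriticalPoint_saddlePairFn_neg (k : Fin (m + 1)) (lam : ℝ) :
    IsNondegCriticalPoint (saddlePairFn k lam) (EuclideanSpace.single k (-1)) (k + 1) := by
  have := isNondegCriticalPoint_modelFn_neg k (s := -1) (by norm_num)
  norm_num at this
  exact this.congr (saddlePairFn_eventuallyEq (single_mem_saddlePairCore k lam (by norm_num)))

theorem isNondegCriticalPoint_saddlePairFn_pos (k : Fin (m + 1)) (lam : ℝ) :
    IsNondegCriticalPoint (saddlePairFn k lam) (EuclideanSpace.single k 1) k := by
  have := isNondegCriticalPoint_modelFn_pos k (s := 1) (by norm_num)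
  norm_num at this
  exact this.congr (saddlePairFn_eventuallyEq (single_mem_saddlePairCore k lam (by norm_num)))

end

section

/-! ### Differential inequalities on a half-line -/

theorem monotoneOn_Ici_of_hasDerivWithinAt_nonneg {y y' : ℝ → ℝ}
    (h : ∀ t, 0 ≤ t → HasDerivWithinAt y (y' t) (Set.Ici 0) t) (h' : ∀ t, 0 ≤ t → 0 ≤ y' t) :
    MonotoneOn y (Set.Ici 0) := by
  refine monotoneOn_of_hasDerivWithinAt_nonneg (f' := y') (convex_Ici 0)
    (fun t ht => (h t ht).continuousWithinAt) (fun t ht => ?_) fun t ht => ?_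
  · exact (h t (interior_subset ht)).mono interior_subset
  · exact h' t (interior_subset ht)

theorem eq_zero_of_tendsto_zero_of_deriv_eq_mul {u b : ℝ → ℝ}
    (h : ∀ t, 0 ≤ t → HasDerivWithinAt u (b t * u t) (Set.Ici 0) t) (hb : ∀ t, 0 ≤ b t)
    (hu : Filter.Tendsto u Filter.atTop (𝓝 0)) {t : ℝ} (ht : 0 ≤ t) : u t = 0 := by
  have hmono : MonotoneOn (fun t => u t ^ 2) (Set.Ici 0) := by
    refine monotoneOn_Ici_of_hasDerivWithinAt_nonneg (y' := fun t => 2 * b t * u t ^ 2)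
      (fun t ht => ?_) fun t _ => ?_
    · refine ((h t ht).fun_pow 2).congr_deriv ?_
      norm_num
      ring
    · have := hb t
      positivity
  have hlim : Filter.Tendsto (fun t => u t ^ 2) Filter.atTop (𝓝 0) := by
    simpa using hu.pow 2
  have hle : u t ^ 2 ≤ 0 := ge_of_tendsto hlim <| by
    filter_upwards [Filter.eventually_ge_atTop t] with s hs
    exact hmono ht (ht.trans hs) hs
  exact pow_eq_zero_iff (two_ne_zero) |>.1 (le_antisymm hle (sq_nonneg _))

theorem nonneg_of_mul_le_deriv {y y' w : ℝ → ℝ} (hw : ContinuousOn w (Set.Ici 0))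
    (h : ∀ t, 0 ≤ t → HasDerivWithinAt y (y' t) (Set.Ici 0) t)
    (h' : ∀ t, 0 ≤ t → w t * y t ≤ y' t) (h0 : 0 ≤ y 0) {t : ℝ} (ht : 0 ≤ t) : 0 ≤ y t := by
  have hw' : Continuous fun t => w (max t 0) :=
    hw.comp_continuous (by fun_prop) fun t => Set.mem_Ici.2 (le_max_right _ _)
  -- the integrating factor is `exp (-W)`, for a primitive `W` of `w`
  set W : ℝ → ℝ := fun t => ∫ s in (0 : ℝ)..t, w (max s 0)
  have hW : ∀ t, 0 ≤ t → HasDerivWithinAt W (w t) (Set.Ici 0) t := by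
    intro t ht
    have := (hw'.integral_hasStrictDerivAt 0 t).hasDerivAt.hasDerivWithinAt (s := Set.Ici 0)
    rwa [max_eq_left ht] at this
  have hmono : MonotoneOn (fun t => y t * Real.exp (-W t)) (Set.Ici 0) := by
    refine monotoneOn_Ici_of_hasDerivWithinAt_nonneg
      (y' := fun t => (y' t - w t * y t) * Real.exp (-W t)) (fun t ht => ?_) fun t ht => ?_
    · refine ((h t ht).fun_mul (hW t ht).fun_neg.exp).congr_deriv ?_
      ring
    · exact mul_nonneg (sub_nonneg.2 (h' t ht)) (Real.exp_pos _).le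
  have h1 := hmono Set.self_mem_Ici ht ht
  have h2 : 0 ≤ y t * Real.exp (-W t) := le_trans (mul_nonneg h0 (Real.exp_pos _).le) h1
  exact nonneg_of_mul_nonneg_left h2 (Real.exp_pos _)

variable {m : ℕ}

/-! ### Trajectories of the gradient -/

theorem HasDerivWithinAt.euclidean_apply {ι : Type*} [Fintype ι] {δ : ℝ → EuclideanSpace ℝ ι}
    {v : EuclideanSpace ℝ ι} {s : Set ℝ} {t : ℝ} (h : HasDerivWithinAt δ v s t) (i : ι) :
    HasDerivWithinAt (fun t => δ t i) (v i) s t :=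
  (EuclideanSpace.proj i : EuclideanSpace ℝ ι →L[ℝ] ℝ).hasFDerivAt.comp_hasDerivWithinAt t h

/-- Reversing time turns the unstable manifold into a stable one. -/
theorem mem_gradUnstable_iff {g : RSp m → ℝ} {Ω : Set (RSp m)} {a x : RSp m} :
    x ∈ gradUnstable g Ω a ↔ ∃ δ : ℝ → RSp m, δ 0 = x ∧
      (∀ t, 0 ≤ t → δ t ∈ Ω ∧
        HasDerivWithinAt δ ((-1 : ℝ) • gradient g (δ t)) (Set.Ici 0) t) ∧
      Filter.Tendsto δ Filter.atTop (𝓝 a) := by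
  have hneg : ∀ (γ : ℝ → RSp m) (v : RSp m) (s s' : Set ℝ) (t : ℝ), Set.MapsTo Neg.neg s' s →
      HasDerivWithinAt γ v s (-t) → HasDerivWithinAt (fun t => γ (-t)) ((-1 : ℝ) • v) s' t := by
    intro γ v s s' t hs h
    exact h.scomp t (hasDerivAt_neg t).hasDerivWithinAt hs
  constructor
  · rintro ⟨γ, h0, h, hlim⟩
    refine ⟨fun t => γ (-t), by simpa using h0, fun t ht => ?_,
      hlim.comp Filter.tendsto_neg_atTop_atBot⟩
    obtain ⟨h1, h2⟩ := h (-t) (by linarith)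
    exact ⟨h1, hneg γ _ _ _ t (fun s hs => by simpa using hs) h2⟩
  · rintro ⟨δ, h0, h, hlim⟩
    refine ⟨fun t => δ (-t), by simpa using h0, fun t ht => ?_,
      hlim.comp Filter.tendsto_neg_atBot_atTop⟩
    obtain ⟨h1, h2⟩ := h (-t) (by linarith)
    have h3 := hneg δ _ _ (Set.Iic 0) t (fun s hs => by simpa using hs) h2
    rw [smul_smul, neg_mul_neg, one_mul, one_smul] at h3
    exact ⟨h1, h3⟩

section

variable {k : Fin (m + 1)} {lam : ℝ} {c : ℝ} {δ : ℝ → RSp m} {a : RSp m}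

/-- Along a trajectory that converges to a point of the axis, the expanding coordinates vanish. -/
theorem apply_eq_zero_of_tendsto (ht : ∀ x, |twist k lam x| < 1) (hc : c ^ 2 = 1)
    (hδ : ∀ t, 0 ≤ t → HasDerivWithinAt δ (c • gradient (saddlePairFn k lam) (δ t)) (Set.Ici 0) t)
    (hlim : Filter.Tendsto δ Filter.atTop (𝓝 a)) {i : Fin (m + 1)} (hi : i ≠ k) (ha : a i = 0)
    (hci : c * modelSign k i = 1) : δ 0 i = 0 := by
  refine eq_zero_of_tendsto_zero_of_deriv_eq_mul (u := fun t => δ t i)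
    (b := fun t => 1 + c * twist k lam (δ t)) (fun t ht => ?_) (fun t => ?_) ?_ le_rfl
  · refine ((hδ t ht).euclidean_apply i).congr_deriv ?_
    rw [PiLp.smul_apply, gradient_saddlePairFn_of_ne hi, smul_eq_mul, ← hci]
    ring
  · have h1 : |c * twist k lam (δ t)| < 1 := by
      have hc' : |c| = 1 := by
        rw [← sq_eq_sq₀ (abs_nonneg c) zero_le_one, sq_abs, hc, one_pow]
      rw [abs_mul, hc', one_mul]
      exact ht _
    linarith [(abs_lt.1 h1).1]
  · rw [← ha]
    exact ((EuclideanSpace.proj i : RSp m →L[ℝ] ℝ).continuous.tendsto a).comp hlim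

/-- The stable manifold of `-e_k` lies on its side of the hyperplane through the other critical
point. -/
theorem gradStable_apply_lt_one {Ω : Set (RSp m)} {x : RSp m}
    (hx : x ∈ gradStable (saddlePairFn k lam) Ω (EuclideanSpace.single k (-1))) : x k < 1 := by
  obtain ⟨γ, rfl, hγ, hlim⟩ := hx
  by_contra! hk
  have hcont : ContinuousOn (fun t => γ t k) (Set.Ici 0) := fun t ht =>
    ((hγ t ht).2.euclidean_apply k).continuousWithinAt
  -- the hyperplane through the other critical point cannot be crossed towards `x k < 1`
  have hge : ∀ t, 0 ≤ t → 0 ≤ γ t k - 1 := fun t ht =>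
    nonneg_of_mul_le_deriv (y := fun t => γ t k - 1) (w := fun t => γ t k + 1)
      (hcont.add continuousOn_const)
      (fun t ht => ((hγ t ht).2.euclidean_apply k).sub_const 1)
      (fun t _ => by linarith [sq_sub_one_le_gradient_saddlePairFn k lam (γ t)])
      (sub_nonneg.2 hk) ht
  have hlim' : Filter.Tendsto (fun t => γ t k) Filter.atTop (𝓝 (-1)) := by
    have := ((EuclideanSpace.proj k : RSp m →L[ℝ] ℝ).continuous.tendsto _).comp hlim
    simpa [Function.comp_def] using this
  have := ge_of_tendsto hlim' (b := 1) <| by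
    filter_upwards [Filter.eventually_ge_atTop 0] with t ht
    linarith [hge t ht]
  linarith

/-- The unstable manifold of `e_k` lies on its side of the hyperplane through the other critical
point. -/
theorem neg_one_lt_gradUnstable_apply {Ω : Set (RSp m)} {x : RSp m}
    (hx : x ∈ gradUnstable (saddlePairFn k lam) Ω (EuclideanSpace.single k 1)) : -1 < x k := by
  obtain ⟨γ, rfl, hγ, hlim⟩ := mem_gradUnstable_iff.1 hx
  by_contra! hk
  have hcont : ContinuousOn (fun t => γ t k) (Set.Ici 0) := fun t ht =>
    ((hγ t ht).2.euclidean_apply k).continuousWithinAt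
  have hge : ∀ t, 0 ≤ t → 0 ≤ -1 - γ t k := fun t ht =>
    nonneg_of_mul_le_deriv (y := fun t => -1 - γ t k) (w := fun t => 1 - γ t k)
      (continuousOn_const.sub hcont)
      (fun t ht => ((hγ t ht).2.euclidean_apply k).const_sub (-1))
      (fun t _ => by
        rw [PiLp.smul_apply, smul_eq_mul]
        linarith [sq_sub_one_le_gradient_saddlePairFn k lam (γ t)])
      (by linarith) ht
  have hlim' : Filter.Tendsto (fun t => γ t k) Filter.atTop (𝓝 1) := by
    have := ((EuclideanSpace.proj k : RSp m →L[ℝ] ℝ).continuous.tendsto _).comp hlim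
    simpa [Function.comp_def] using this
  have := le_of_tendsto hlim' (b := -1) <| by
    filter_upwards [Filter.eventually_ge_atTop 0] with t ht
    linarith [hge t ht]
  linarith

end

/-- The solution `(A e⁻ᵗ - B eᵗ) / (A e⁻ᵗ + B eᵗ)`, with `A = 1 + s` and `B = 1 - s`, of the
equation `y' = y² - 1` with initial value `s`. -/
def riccatiSol (s t : ℝ) : ℝ :=
  ((1 + s) * Real.exp (-t) - (1 - s) * Real.exp t) /
    ((1 + s) * Real.exp (-t) + (1 - s) * Real.exp t)

section

variable {s : ℝ}

theorem riccatiSol_zero (s : ℝ) : riccatiSol s 0 = s := by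
  simp [riccatiSol]
  ring

theorem riccatiSol_neg (s t : ℝ) : riccatiSol s (-t) = -riccatiSol (-s) t := by
  simp only [riccatiSol, neg_neg, ← neg_div]
  congr 1 <;> ring

theorem riccatiSol_denom_pos (h1 : -1 < s) (h2 : s < 1) (t : ℝ) :
    0 < (1 + s) * Real.exp (-t) + (1 - s) * Real.exp t :=
  add_pos (mul_pos (by linarith) (Real.exp_pos _)) (mul_pos (by linarith) (Real.exp_pos _))

theorem sq_riccatiSol_lt_one (h1 : -1 < s) (h2 : s < 1) (t : ℝ) : riccatiSol s t ^ 2 < 1 := by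
  have hD := riccatiSol_denom_pos h1 h2 t
  have hA : 0 < (1 + s) * Real.exp (-t) := mul_pos (by linarith) (Real.exp_pos _)
  have hB : 0 < (1 - s) * Real.exp t := mul_pos (by linarith) (Real.exp_pos _)
  rw [riccatiSol, div_pow, div_lt_one (by positivity)]
  nlinarith

theorem hasDerivAt_riccatiSol (h1 : -1 < s) (h2 : s < 1) (t : ℝ) :
    HasDerivAt (riccatiSol s) (riccatiSol s t ^ 2 - 1) t := by
  have hD := riccatiSol_denom_pos h1 h2 t
  have hA : HasDerivAt (fun t => (1 + s) * Real.exp (-t)) (-((1 + s) * Real.exp (-t))) t := by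
    refine ((hasDerivAt_neg t).exp.const_mul (1 + s)).congr_deriv ?_
    ring
  have hB : HasDerivAt (fun t => (1 - s) * Real.exp t) ((1 - s) * Real.exp t) t :=
    (Real.hasDerivAt_exp t).const_mul (1 - s)
  refine ((hA.sub hB).div (hA.add hB) hD.ne').congr_deriv ?_
  simp only [Pi.add_apply, Pi.sub_apply, riccatiSol]
  field_simp
  ring

theorem tendsto_riccatiSol (h2 : s < 1) :
    Filter.Tendsto (riccatiSol s) Filter.atTop (𝓝 (-1)) := by
  have hexp : Filter.Tendsto (fun t : ℝ => Real.exp (-(2 * t))) Filter.atTop (𝓝 0) :=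
    Real.tendsto_exp_neg_atTop_nhds_zero.comp
      (Filter.tendsto_id.const_mul_atTop (by norm_num : (0 : ℝ) < 2))
  have h : riccatiSol s = fun t => ((1 + s) * Real.exp (-(2 * t)) - (1 - s)) /
      ((1 + s) * Real.exp (-(2 * t)) + (1 - s)) := by
    ext t
    have : Real.exp (-t) = Real.exp (-(2 * t)) * Real.exp t := by
      rw [← Real.exp_add]
      ring_nf
    rw [riccatiSol, this, ← mul_assoc, ← sub_mul, ← add_mul,
      mul_div_mul_right _ _ (Real.exp_pos t).ne']
  rw [h]
  have hB : (1 + s) * 0 + (1 - s) ≠ 0 := by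
    rw [mul_zero, zero_add]
    linarith
  have := ((hexp.const_mul (1 + s)).sub_const (1 - s)).div
    ((hexp.const_mul (1 + s)).add_const (1 - s)) hB
  have hval : ((1 + s) * 0 - (1 - s)) / ((1 + s) * 0 + (1 - s)) = -1 := by
    rw [mul_zero, zero_sub, zero_add, neg_div, div_self (by linarith)]
  rwa [hval] at this

end

/-- The trajectory of the gradient of the model function with parameter `1` that starts at `x`. -/
def modelTraj (k : Fin (m + 1)) (x : RSp m) (t : ℝ) : RSp m :=
  WithLp.toLp 2 fun i => if i = k then riccatiSol (x k) t else x i * Real.exp (modelSign k i * t)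

theorem modelTraj_self (k : Fin (m + 1)) (x : RSp m) (t : ℝ) :
    modelTraj k x t k = riccatiSol (x k) t := by
  simp [modelTraj]

theorem modelTraj_of_ne {k i : Fin (m + 1)} (h : i ≠ k) (x : RSp m) (t : ℝ) :
    modelTraj k x t i = x i * Real.exp (modelSign k i * t) := by
  simp [modelTraj, h]

theorem modelTraj_zero (k : Fin (m + 1)) (x : RSp m) : modelTraj k x 0 = x := by
  ext i
  by_cases h : i = k
  · subst h
    rw [modelTraj_self, riccatiSol_zero]
  · rw [modelTraj_of_ne h, mul_zero, Real.exp_zero, mul_one]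

theorem hasDerivAt_modelTraj {k : Fin (m + 1)} {x : RSp m} (h1 : -1 < x k) (h2 : x k < 1) (t : ℝ) :
    HasDerivAt (modelTraj k x) (gradient (modelFn k 1) (modelTraj k x t)) t := by
  have h : HasDerivAt (fun t i => modelTraj k x t i)
      (fun i => gradient (modelFn k 1) (modelTraj k x t) i) t := by
    rw [hasDerivAt_pi]
    intro i
    rw [gradient_modelFn, modelTermDeriv]
    split_ifs with hi
    · subst hi
      simp only [modelTraj_self]
      exact hasDerivAt_riccatiSol h1 h2 t
    · simp only [modelTraj_of_ne hi]
      refine (((hasDerivAt_id t).const_mul (modelSign k i)).exp.const_mul (x i)).congr_deriv ?_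
      simp only [id]
      ring
  exact (PiLp.continuousLinearEquiv 2 ℝ fun _ : Fin (m + 1) => ℝ).symm.hasFDerivAt.comp_hasDerivAt
    t h

/-- If the coordinates that the flow expands vanish at `x`, the trajectory of `x` stays near the
segment between the critical points and converges to the one it flows to. Here `c = 1` stands for
the flow forward in time and `c = -1` for the flow backward in time. -/
theorem modelTraj_spec {k : Fin (m + 1)} {lam : ℝ} (hlam : 0 < lam) {c : ℝ} (hc : c = 1 ∨ c = -1)
    {x : RSp m} (hx : x ∈ saddlePairCore k lam) (h1 : -1 < x k) (h2 : x k < 1)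
    (h0 : ∀ i ≠ k, c * modelSign k i = 1 → x i = 0) :
    (∀ t, 0 ≤ t → modelTraj k x (c * t) ∈ saddlePairCore k lam ∧
      HasDerivWithinAt (fun t => modelTraj k x (c * t))
        (c • gradient (saddlePairFn k lam) (modelTraj k x (c * t))) (Set.Ici 0) t) ∧
    Filter.Tendsto (fun t => modelTraj k x (c * t)) Filter.atTop
      (𝓝 (EuclideanSpace.single k (-c))) := by
  have hform : ∀ i ≠ k, ∀ t, modelTraj k x (c * t) i = x i * Real.exp (-t) := by
    intro i hi t
    rw [modelTraj_of_ne hi]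
    by_cases h : c * modelSign k i = 1
    · rw [h0 i hi h, zero_mul, zero_mul]
    · have : c * modelSign k i = -1 := by
        refine (eq_or_eq_neg_of_sq_eq_sq _ 1 ?_).resolve_left h
        rw [mul_pow, modelSign_sq]
        rcases hc with rfl | rfl <;> norm_num
      rw [← mul_assoc, mul_comm _ c, this, neg_one_mul]
  have hcore : ∀ t, 0 ≤ t → modelTraj k x (c * t) ∈ saddlePairCore k lam := by
    intro t ht
    constructor
    · refine lt_of_le_of_lt (mul_le_mul_of_nonneg_left ?_ hlam.le) hx.1
      refine Finset.sum_le_sum fun i _ => ?_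
      split_ifs with hi
      · exact le_rfl
      · rw [hform i hi, mul_pow]
        have h3 : Real.exp (-t) ≤ 1 := Real.exp_le_one_iff.2 (by linarith)
        have h4 : Real.exp (-t) ^ 2 ≤ 1 := pow_le_one₀ (Real.exp_pos _).le h3
        nlinarith [sq_nonneg (x i)]
    · have := sq_riccatiSol_lt_one h1 h2 (c * t)
      rw [modelTraj_self]
      linarith
  refine ⟨fun t ht => ⟨hcore t ht, ?_⟩, ?_⟩
  · have hgrad : gradient (saddlePairFn k lam) (modelTraj k x (c * t))
        = gradient (modelFn k 1) (modelTraj k x (c * t)) := by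
      rw [gradient, gradient, (saddlePairFn_eventuallyEq (hcore t ht)).fderiv_eq]
    rw [hgrad]
    have h3 : HasDerivAt (fun t => c * t) c t := by
      simpa using (hasDerivAt_id t).const_mul c
    exact ((hasDerivAt_modelTraj h1 h2 (c * t)).scomp t h3).hasDerivWithinAt
  · have hpi : Filter.Tendsto (fun t i => modelTraj k x (c * t) i) Filter.atTop
        (𝓝 fun i => (EuclideanSpace.single k (-c) : RSp m) i) := by
      rw [tendsto_pi_nhds]
      intro i
      by_cases hi : i = k
      · subst hi
        simp only [modelTraj_self, PiLp.single_apply, if_true]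
        rcases hc with rfl | rfl
        · simpa using tendsto_riccatiSol h2
        · have := (tendsto_riccatiSol (s := -x i) (by linarith)).neg
          simp only [neg_one_mul, riccatiSol_neg, neg_neg] at this ⊢
          exact this
      · simp only [hform i hi, PiLp.single_apply, hi, if_false]
        simpa using Real.tendsto_exp_neg_atTop_nhds_zero.const_mul (x i)
    exact ((PiLp.continuous_toLp 2 fun _ : Fin (m + 1) => ℝ).tendsto _).comp hpi

/-! ### The stable and the unstable manifold -/

theorem hasTangentSpaceAt_of_isOpen {S N : Set (RSp m)} {V : Submodule ℝ (RSp m)} {x : RSp m}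
    (hN : IsOpen N) (hxN : x ∈ N) (hx : x ∈ S) (h : ∀ y ∈ N, y ∈ V ↔ y ∈ S) :
    HasTangentSpaceAt S x V := by
  refine ⟨hx, OpenPartialHomeomorph.ofSet N hN, hxN, contDiff_id.contDiffOn,
    contDiff_id.contDiffOn, V, h, ?_⟩
  have : fderiv ℝ (OpenPartialHomeomorph.ofSet N hN) x = ContinuousLinearMap.id ℝ (RSp m) :=
    fderiv_id
  rw [this]
  rfl

/-- The vectors whose coordinates with the given property vanish. -/
def coordSubspace (P : Fin (m + 1) → Prop) : Submodule ℝ (RSp m) where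
  carrier := {v | ∀ i, P i → v i = 0}
  add_mem' := fun {v w} hv hw i hi => by simp [hv i hi, hw i hi]
  zero_mem' := fun i _ => rfl
  smul_mem' := fun c v hv i hi => by simp [hv i hi]

theorem coordSubspace_sup_eq_top {P Q : Fin (m + 1) → Prop} (h : ∀ i, P i → ¬ Q i) :
    coordSubspace P ⊔ coordSubspace Q = ⊤ := by
  classical
  rw [eq_top_iff]
  intro v _
  rw [Submodule.mem_sup]
  refine ⟨WithLp.toLp 2 fun i => if P i then 0 else v i, fun i hi => by simp [hi],
    WithLp.toLp 2 fun i => if P i then v i else 0, fun i hi => ?_, ?_⟩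
  · have : ¬ P i := fun h' => h i h' hi
    simp [this]
  · ext i
    by_cases hi : P i <;> simp [hi]

section

variable {k : Fin (m + 1)} {lam : ℝ} {Ω : Set (RSp m)}

theorem gradStable_saddlePairFn_subset (ht : ∀ x, |twist k lam x| < 1) {x : RSp m}
    (hx : x ∈ gradStable (saddlePairFn k lam) Ω (EuclideanSpace.single k (-1))) :
    x ∈ coordSubspace (k < ·) := by
  obtain ⟨γ, rfl, hγ, hlim⟩ := hx
  intro i hi
  refine apply_eq_zero_of_tendsto ht (c := 1) (by norm_num)
    (fun t ht => by simpa using (hγ t ht).2) hlim hi.ne' (by simp [hi.ne']) ?_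
  simp [modelSign, hi.not_gt]

theorem gradUnstable_saddlePairFn_subset (ht : ∀ x, |twist k lam x| < 1) {x : RSp m}
    (hx : x ∈ gradUnstable (saddlePairFn k lam) Ω (EuclideanSpace.single k 1)) :
    x ∈ coordSubspace (· < k) := by
  obtain ⟨γ, rfl, hγ, hlim⟩ := mem_gradUnstable_iff.1 hx
  intro i hi
  refine apply_eq_zero_of_tendsto ht (c := -1) (by norm_num)
    (fun t ht => (hγ t ht).2) hlim hi.ne (by simp [hi.ne]) ?_
  simp [modelSign, hi]

theorem mem_gradStable_saddlePairFn (hlam : 0 < lam) (hΩ : saddlePairCore k lam ⊆ Ω) {x : RSp m}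
    (hx : x ∈ saddlePairCore k lam) (h1 : -1 < x k) (h2 : x k < 1)
    (h0 : x ∈ coordSubspace (k < ·)) :
    x ∈ gradStable (saddlePairFn k lam) Ω (EuclideanSpace.single k (-1)) := by
  obtain ⟨h3, h4⟩ := modelTraj_spec hlam (.inl rfl) hx h1 h2 fun i hi hs => h0 i <| by
    refine lt_of_le_of_ne (not_lt.1 fun h => ?_) (Ne.symm hi)
    simp only [modelSign, h, if_true] at hs
    norm_num at hs
  simp only [one_mul, one_smul] at h3 h4
  exact ⟨modelTraj k x, modelTraj_zero k x, fun t ht => ⟨hΩ (h3 t ht).1, (h3 t ht).2⟩, h4⟩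

theorem mem_gradUnstable_saddlePairFn (hlam : 0 < lam) (hΩ : saddlePairCore k lam ⊆ Ω) {x : RSp m}
    (hx : x ∈ saddlePairCore k lam) (h1 : -1 < x k) (h2 : x k < 1)
    (h0 : x ∈ coordSubspace (· < k)) :
    x ∈ gradUnstable (saddlePairFn k lam) Ω (EuclideanSpace.single k 1) := by
  obtain ⟨h3, h4⟩ := modelTraj_spec hlam (.inr rfl) hx h1 h2 fun i hi hs => h0 i <| by
    by_contra h
    simp only [modelSign, h, if_false] at hs
    norm_num at hs
  rw [neg_neg] at h4
  refine mem_gradUnstable_iff.2 ⟨fun t => modelTraj k x (-1 * t), ?_,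
    fun t ht => ⟨hΩ (h3 t ht).1, (h3 t ht).2⟩, h4⟩
  simp only [mul_zero, modelTraj_zero]

theorem gradStable_inter_gradUnstable_nonempty (hlam : 0 < lam) (hΩ : saddlePairCore k lam ⊆ Ω) :
    (gradStable (saddlePairFn k lam) Ω (EuclideanSpace.single k (-1)) ∩
      gradUnstable (saddlePairFn k lam) Ω (EuclideanSpace.single k 1)).Nonempty := by
  have h0 : (0 : RSp m) ∈ saddlePairCore k lam := by
    constructor
    · rw [transSq_eq_zero fun _ _ => rfl, mul_zero]
      exact one_pos
    · norm_num
  exact ⟨0, mem_gradStable_saddlePairFn hlam hΩ h0 (by norm_num) (by norm_num) (zero_mem _),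
    mem_gradUnstable_saddlePairFn hlam hΩ h0 (by norm_num) (by norm_num) (zero_mem _)⟩

/-- The stable and the unstable manifold meet exactly in the open segment between the critical
points, and near this segment they are linear subspaces. -/
theorem intersectTransversely_saddlePairFn (hlam : 0 < lam) (ht : ∀ x, |twist k lam x| < 1)
    (hΩ : saddlePairCore k lam ⊆ Ω) :
    IntersectTransversely (gradStable (saddlePairFn k lam) Ω (EuclideanSpace.single k (-1)))
      (gradUnstable (saddlePairFn k lam) Ω (EuclideanSpace.single k 1)) := by
  rintro x ⟨hs, hu⟩
  set N : Set (RSp m) := saddlePairCore k lam ∩ {y | -1 < y k ∧ y k < 1}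
  have hN : IsOpen N := by
    have h : Continuous fun y : RSp m => y k := by fun_prop
    exact (isOpen_saddlePairCore k lam).inter
      ((isOpen_lt continuous_const h).inter (isOpen_lt h continuous_const))
  have h1 := neg_one_lt_gradUnstable_apply hu
  have h2 := gradStable_apply_lt_one hs
  have hxN : x ∈ N := by
    refine ⟨⟨?_, by nlinarith⟩, h1, h2⟩
    have : transSq k x = 0 := transSq_eq_zero fun i hi => by
      rcases lt_or_gt_of_ne hi with h | h
      · exact gradUnstable_saddlePairFn_subset ht hu i h
      · exact gradStable_saddlePairFn_subset ht hs i h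
    rw [this, mul_zero]
    exact one_pos
  refine ⟨coordSubspace (k < ·), coordSubspace (· < k),
    hasTangentSpaceAt_of_isOpen hN hxN hs fun y hy =>
      ⟨mem_gradStable_saddlePairFn hlam hΩ hy.1 hy.2.1 hy.2.2,
        gradStable_saddlePairFn_subset ht⟩,
    hasTangentSpaceAt_of_isOpen hN hxN hu fun y hy =>
      ⟨mem_gradUnstable_saddlePairFn hlam hΩ hy.1 hy.2.1 hy.2.2,
        gradUnstable_saddlePairFn_subset ht⟩,
    coordSubspace_sup_eq_top fun i hi => not_lt.2 hi.le⟩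

end

end

section

variable {m : ℕ}

/-! ### The box coordinates -/

/-- The increasing diffeomorphism `s ↦ s³ / 3 + s` of the line. -/
theorem exists_cubic_homeomorph : ∃ c : ℝ ≃ₜ ℝ, (∀ s, c s = s ^ 3 / 3 + s) ∧
    ContDiff ℝ ∞ c.symm := by
  let f : ℝ → ℝ := fun s => s ^ 3 / 3 + s
  have hd : ∀ s, HasDerivAt f (s ^ 2 + 1) s := fun s => by
    refine (((hasDerivAt_pow 3 s).div_const 3).add (hasDerivAt_id s)).congr_deriv ?_
    norm_num
  have hmono : StrictMono f := strictMono_of_hasDerivAt_pos hd fun s => by positivity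
  have hcont : ContDiff ℝ ∞ f := by fun_prop
  have hsurj : Function.Surjective f := by
    refine hcont.continuous.surjective ?_ ?_
    · refine Filter.tendsto_atTop_mono' _ ?_ Filter.tendsto_id
      filter_upwards [Filter.eventually_ge_atTop 0] with s hs
      have : 0 ≤ s ^ 3 := by positivity
      simp only [f, id]
      linarith
    · refine Filter.tendsto_atBot_mono' _ ?_ Filter.tendsto_id
      filter_upwards [Filter.eventually_le_atBot 0] with s hs
      have : s ^ 3 ≤ 0 := by nlinarith [sq_nonneg s]
      simp only [f, id]
      linarith
  let c := (hmono.orderIsoOfSurjective f hsurj).toHomeomorph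
  have hc : ∀ s, c s = f s := fun s => rfl
  refine ⟨c, hc, Homeomorph.contDiff_symm_deriv (f' := fun s => s ^ 2 + 1) c
    (fun s => by positivity) hd hcont⟩

theorem transSq_eq_sum_succAbove (k : Fin (m + 1)) (x : RSp m) :
    transSq k x = ∑ j : Fin m, x (k.succAbove j) ^ 2 := by
  rw [transSq, Fin.sum_univ_succAbove _ k]
  simp

/-- The model function without critical points is, up to a constant, the last coordinate of a global
diffeomorphism, whose other coordinates are those of index `≠ k` up to a constant. -/
theorem exists_box_coordinates (k : Fin (m + 1)) {r h : ℝ} (hr : r ≠ 0) (hh : h ≠ 0) :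
    ∃ Θ : RSp m ≃ₜ RSp m, ContDiff ℝ ∞ Θ ∧ ContDiff ℝ ∞ Θ.symm ∧
      ∀ x, Θ x (Fin.last m) = h * modelFn k (-1) x ∧
        ∑ j : Fin m, Θ x j.castSucc ^ 2 = r ^ 2 * transSq k x := by
  obtain ⟨c, hc, hcs⟩ := exists_cubic_homeomorph
  set Q : (Fin m → ℝ) → ℝ := fun v =>
    ∑ j, modelTerm k (-1) (k.succAbove j) (v j)
  have hQ : ContDiff ℝ ∞ Q := by
    refine ContDiff.sum fun j _ => ?_
    simp only [modelTerm, Fin.succAbove_ne, if_false]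
    fun_prop
  have hmodel : ∀ x : RSp m, modelFn k (-1) x = c (x k) + Q fun j => x (k.succAbove j) := by
    intro x
    rw [modelFn_eq_sum, Fin.sum_univ_succAbove _ k, hc, modelTerm, if_pos rfl]
    ring
  let A : RSp m → RSp m := fun x => WithLp.toLp 2
    (Fin.snoc (α := fun _ => ℝ) (fun j => r * x (k.succAbove j)) (h * modelFn k (-1) x))
  let B : RSp m → RSp m := fun z => WithLp.toLp 2
    (k.insertNth (α := fun _ => ℝ)
      (c.symm (h⁻¹ * z (Fin.last m) - Q fun j => r⁻¹ * z j.castSucc))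
      (fun j => r⁻¹ * z j.castSucc))
  have hA1 : ∀ x, A x (Fin.last m) = h * modelFn k (-1) x := fun x => by simp [A]
  have hA2 : ∀ x (j : Fin m), A x j.castSucc = r * x (k.succAbove j) := fun x j => by simp [A]
  have hB1 : ∀ z, B z k = c.symm (h⁻¹ * z (Fin.last m) - Q fun j => r⁻¹ * z j.castSucc) :=
    fun z => by simp [B]
  have hB2 : ∀ z (j : Fin m), B z (k.succAbove j) = r⁻¹ * z j.castSucc := fun z j => by simp [B]
  have hA : ContDiff ℝ ∞ A := by
    rw [contDiff_euclidean]
    intro i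
    induction i using Fin.lastCases with
    | last =>
      simp only [hA1]
      exact contDiff_const.mul (contDiff_modelFn k (-1))
    | cast j =>
      simp only [hA2]
      fun_prop
  have hB : ContDiff ℝ ∞ B := by
    rw [contDiff_euclidean]
    intro i
    rcases Fin.eq_self_or_eq_succAbove k i with rfl | ⟨j, rfl⟩
    · simp only [hB1]
      refine hcs.comp (ContDiff.sub (by fun_prop) (hQ.comp ?_))
      rw [contDiff_pi]
      intro j
      fun_prop
    · simp only [hB2]
      fun_prop
  let Θ : RSp m ≃ₜ RSp m :=
    { toFun := A
      invFun := B
      left_inv := fun x => by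
        ext i
        rcases Fin.eq_self_or_eq_succAbove k i with rfl | ⟨j, rfl⟩
        · rw [hB1, hA1]
          simp only [hA2, inv_mul_cancel_left₀ hh, inv_mul_cancel_left₀ hr]
          rw [hmodel, add_sub_cancel_right, Homeomorph.symm_apply_apply]
        · rw [hB2, hA2, inv_mul_cancel_left₀ hr]
      right_inv := fun z => by
        ext i
        induction i using Fin.lastCases with
        | last =>
          rw [hA1, hmodel, hB1, Homeomorph.apply_symm_apply]
          simp only [hB2]
          rw [sub_add_cancel, mul_inv_cancel_left₀ hh]
        | cast j => rw [hA2, hB2, mul_inv_cancel_left₀ hr]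
      continuous_toFun := hA.continuous
      continuous_invFun := hB.continuous }
  refine ⟨Θ, hA, hB, fun x => ⟨hA1 x, ?_⟩⟩
  change ∑ j : Fin m, A x j.castSucc ^ 2 = _
  rw [transSq_eq_sum_succAbove, Finset.mul_sum]
  simp only [hA2, mul_pow]

/-! ### Morse singularities in a chart -/

theorem contDiffOn_of_mem_contDiffGroupoid {n : ℕ}
    {e : OpenPartialHomeomorph (EuclideanSpace ℝ (Fin n)) (EuclideanSpace ℝ (Fin n))}
    (he : e ∈ contDiffGroupoid ∞ (𝓡 n)) : ContDiffOn ℝ ∞ e e.source := by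
  rw [contDiffGroupoid, mem_groupoid_of_pregroupoid] at he
  simpa [contDiffPregroupoid] using he.1

theorem exists_fderiv_eq_equiv {E : Type*} [NormedAddCommGroup E] [NormedSpace ℝ E]
    (e : OpenPartialHomeomorph E E) {x : E} (hx : x ∈ e.source) (h : DifferentiableAt ℝ e x)
    (h' : DifferentiableAt ℝ e.symm (e x)) : ∃ L : E ≃L[ℝ] E, fderiv ℝ e x = L := by
  have h1 : (fderiv ℝ e.symm (e x)).comp (fderiv ℝ e x) = ContinuousLinearMap.id ℝ E :=
    (h'.hasFDerivAt.comp x h.hasFDerivAt).unique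
      ((hasFDerivAt_id x).congr_of_eventuallyEq (e.eventually_left_inverse hx))
  have h2 : (fderiv ℝ e x).comp (fderiv ℝ e.symm (e x)) = ContinuousLinearMap.id ℝ E := by
    have h3 : HasFDerivAt e (fderiv ℝ e x) (e.symm (e x)) := by
      rw [e.left_inv hx]
      exact h.hasFDerivAt
    exact (h3.comp (e x) h'.hasFDerivAt).unique
      ((hasFDerivAt_id (e x)).congr_of_eventuallyEq
        (e.eventually_right_inverse (e.map_source hx)))
  exact ⟨ContinuousLinearEquiv.equivOfInverse _ _ (fun v => DFunLike.congr_fun h1 v)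
    fun v => DFunLike.congr_fun h2 v, rfl⟩

theorem gradient_eq_zero_iff {E : Type*} [NormedAddCommGroup E] [InnerProductSpace ℝ E]
    [CompleteSpace E] (g : E → ℝ) (x : E) : gradient g x = 0 ↔ fderiv ℝ g x = 0 := by
  rw [gradient, LinearIsometryEquiv.map_eq_zero_iff]

variable {M : Type*} [TopologicalSpace M] [ChartedSpace (RSp m) M]

theorem SingFoliation.isMorseSingularity_of_chart [IsManifold (𝓡 (m + 1)) ∞ M]
    (F : SingFoliation m M) {ψ : OpenPartialHomeomorph M (RSp m)}
    (hψ : ψ ∈ IsManifold.maximalAtlas (𝓡 (m + 1)) ∞ M) {g : RSp m → ℝ} (hg : ContDiff ℝ ∞ g)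
    {W : Set M} (hW : IsOpen W) (hWψ : W ⊆ ψ.source) {p : M} (hp : W ∩ F.sing = {p})
    (hcrit : ∀ x ∈ W, gradient g (ψ x) = 0 ↔ x = p) {l : ℕ}
    (hnd : IsNondegCriticalPoint g (ψ p) l) (hF : F.IsFirstIntegral W (g ∘ ψ)) :
    F.IsMorseSingularity p l := by
  have hpψ : p ∈ ψ.source := by
    have : p ∈ W ∩ F.sing := hp ▸ rfl
    exact hWψ this.1
  have hψs : ContMDiffOn (𝓡 (m + 1)) (𝓡 (m + 1)) ∞ ψ ψ.source :=
    contMDiffOn_of_mem_maximalAtlas hψ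
  have hψs' : ContMDiffOn (𝓡 (m + 1)) (𝓡 (m + 1)) ∞ ψ.symm ψ.target :=
    contMDiffOn_symm_of_mem_maximalAtlas hψ
  have hψd : ψ.MDifferentiable (𝓡 (m + 1)) (𝓡 (m + 1)) :=
    ⟨hψs.mdifferentiableOn (by simp), hψs'.mdifferentiableOn (by simp)⟩
  refine ⟨W, hW, hp, g ∘ ψ, hg.contMDiff.comp_contMDiffOn (hψs.mono hWψ), fun x hx => ?_, ?_, hF⟩
  · have hgd : MDifferentiableAt (𝓡 (m + 1)) 𝓘(ℝ, ℝ) g (ψ x) :=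
      (hg.differentiable (by simp) (ψ x)).mdifferentiableAt
    rw [mfderiv_comp x hgd (hψd.mdifferentiableAt (hWψ hx)), mfderiv_eq_fderiv, ← hcrit x hx,
      gradient_eq_zero_iff]
    have hsurj := hψd.mfderiv_surjective (hWψ hx)
    constructor
    · intro h
      ext v
      obtain ⟨w, rfl⟩ := hsurj v
      exact DFunLike.congr_fun h w
    · intro h
      ext v
      exact DFunLike.congr_fun h (mfderiv (𝓡 (m + 1)) (𝓡 (m + 1)) ψ x v)
  · set c := chartAt (RSp m) p
    have hc : c ∈ IsManifold.maximalAtlas (𝓡 (m + 1)) ∞ M := IsManifold.chart_mem_maximalAtlas p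
    have hpc : p ∈ c.source := mem_chart_source _ p
    set e := c.symm.trans ψ
    have hes : c p ∈ e.source := by
      rw [OpenPartialHomeomorph.trans_source]
      refine ⟨c.map_source hpc, ?_⟩
      rw [Set.mem_preimage, c.left_inv hpc]
      exact hpψ
    have hep : e (c p) = ψ p := by
      change ψ (c.symm (c p)) = ψ p
      rw [c.left_inv hpc]
    have h1 : ContDiffOn ℝ ∞ e e.source :=
      contDiffOn_of_mem_contDiffGroupoid (IsManifold.compatible_of_mem_maximalAtlas hc hψ)
    have h2 : ContDiffOn ℝ ∞ e.symm e.target :=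
      contDiffOn_of_mem_contDiffGroupoid ((contDiffGroupoid ∞ (𝓡 (m + 1))).symm
        (IsManifold.compatible_of_mem_maximalAtlas hc hψ))
    have h1' := h1.contDiffAt (e.open_source.mem_nhds hes)
    have h2' := h2.contDiffAt (e.open_target.mem_nhds (e.map_source hes))
    obtain ⟨L, hL⟩ := exists_fderiv_eq_equiv e hes (h1'.differentiableAt (by simp))
      (h2'.differentiableAt (by simp))
    exact IsNondegCriticalPoint.comp (g := g) (τ := e) (hep.symm ▸ hnd) hg.contDiffAt h1' L hL

end

end

/-! ### Creation of a pair of saddles -/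

theorem proposition4p4 {m : ℕ} (hm : 2 ≤ m) {M : Type*} [TopologicalSpace M] [T2Space M]
    [Nonempty M] [ChartedSpace (RSp m) M] [IsManifold (𝓡 (m + 1)) ∞ M]
    (F : SingFoliation m M) :
    F.charts.Nonempty ∧
    ∀ φ ∈ F.charts, ∀ k : Fin (m + 1), 0 < k → k < Fin.last m →
      ∃ (F' : SingFoliation m M) (p q : M)
        (ψ : OpenPartialHomeomorph M (RSp m)) (g : RSp m → ℝ) (ε' ε'' : ℝ) (K : Set (RSp m)),
        -- the singular set, the type of the new singularities, and their connection
        p ∈ φ.source ∧ q ∈ φ.source ∧ p ≠ q ∧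
        F'.sing = F.sing ∪ {p, q} ∧
        F'.IsSaddle p (k + 1) ∧ F'.IsSaddle q k ∧
        F'.ConnectTransversely ψ g p q ∧
        IsNondegCriticalPoint g (ψ p) (k + 1) ∧ IsNondegCriticalPoint g (ψ q) k ∧
        -- the modification takes place in a compact part of the domain of the foliated chart
        ψ.source = φ.source ∧ IsCompact K ∧ K ⊆ ψ.target ∧
        F'.AgreeOn F (ψ.source ∩ ψ ⁻¹' K)ᶜ ∧
        -- and replaces the local model with a negative parameter by the one with a positive one
        ε' < 0 ∧ 0 < ε'' ∧
        F.IsFirstIntegral ψ.source (modelFn k ε' ∘ ψ) ∧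
        (∀ z ∈ ψ.target \ K, g z = modelFn k ε' z) ∧
        ψ p = EuclideanSpace.single k (-√ε'') ∧ ψ q = EuclideanSpace.single k √ε'' ∧
        (∀ᶠ z in 𝓝ˢ (segment ℝ (ψ p) (ψ q)), g z = modelFn k ε'' z) := by
  refine ⟨F.charts_nonempty, fun φ hφ k hk0 hk => ?_⟩
  obtain ⟨lam, hlam, htwist⟩ := exists_abs_twist_lt_one (m := m)
  set g := saddlePairFn k lam
  set K := saddlePairSupport k lam
  have hg : ContDiff ℝ ∞ g := contDiff_saddlePairFn k lam
  have hK : IsCompact K := isCompact_saddlePairSupport k hlam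
  obtain ⟨b, hb⟩ := hK.exists_bound_of_continuousOn
    (contDiff_modelFn k (-1)).continuous.continuousOn
  -- the box coordinates are scaled such that `K` lies in the unit box
  have hh : (|b| + 1)⁻¹ ≠ 0 := by positivity
  have hr : √(lam / 3) ≠ 0 := by positivity
  obtain ⟨Θ, hΘ, hΘs, hΘform⟩ := exists_box_coordinates k hr hh
  have hKbox : ∀ z ∈ K, Θ z ∈ unitBox m := by
    intro z hz
    obtain ⟨h1, h2⟩ := hΘform z
    constructor
    · rw [h2, Real.sq_sqrt (by positivity)]
      have := hz.1
      linarith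
    · rw [h1, abs_mul, abs_of_pos (by positivity : 0 < (|b| + 1)⁻¹),
        inv_mul_lt_one₀ (by positivity)]
      have := hb z hz
      rw [Real.norm_eq_abs] at this
      linarith [le_abs_self b]
  set e : OpenPartialHomeomorph (RSp m) (RSp m) := Θ.symm.toOpenPartialHomeomorph
  have he : e ∈ contDiffGroupoid ∞ (𝓡 (m + 1)) :=
    mem_contDiffGroupoid_of_contDiffOn hΘs.contDiffOn hΘ.contDiffOn
  set ψ := φ.trans e
  have hψ : ψ ∈ IsManifold.maximalAtlas (𝓡 (m + 1)) ∞ M :=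
    trans_mem_maximalAtlas (F.smooth φ hφ) he
  have hsrc : ψ.source = φ.source := by simp [ψ, e]
  have htgt : ∀ z, z ∈ ψ.target ↔ Θ z ∈ unitBox m := by
    intro z
    rw [← F.target_eq φ hφ]
    simp [ψ, e]
  have hlast : ∀ x, lastCoord φ x = (|b| + 1)⁻¹ * modelFn k (-1) (ψ x) := by
    intro x
    rw [← (hΘform (ψ x)).1]
    change _ = Θ (Θ.symm (φ x)) _
    rw [Homeomorph.apply_symm_apply]
    rfl
  have hKt : K ⊆ ψ.target := fun z hz => (htgt z).2 (hKbox z hz)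
  have hcore : saddlePairCore k lam ⊆ ψ.target := (saddlePairCore_subset k lam).trans hKt
  have hmem : ∀ s : ℝ, s ^ 2 < 2 → (EuclideanSpace.single k s : RSp m) ∈ saddlePairCore k lam :=
    fun s hs => single_mem_saddlePairCore k lam hs
  have hmem1 := hmem (-1) (by norm_num)
  have hmem2 := hmem 1 (by norm_num)
  set p := ψ.symm (EuclideanSpace.single k (-1))
  set q := ψ.symm (EuclideanSpace.single k 1)
  have hψp : ψ p = EuclideanSpace.single k (-1) := ψ.right_inv (hcore hmem1)
  have hψq : ψ q = EuclideanSpace.single k 1 := ψ.right_inv (hcore hmem2)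
  have hp : p ∈ ψ.source := ψ.map_target (hcore hmem1)
  have hq : q ∈ ψ.source := ψ.map_target (hcore hmem2)
  have hpq : p ≠ q := by
    intro h
    have h1 := congrArg (fun z : RSp m => z k) (hψp.symm.trans ((congrArg ψ h).trans hψq))
    norm_num at h1
  have hcrit : ∀ x ∈ ψ.source, gradient g (ψ x) = 0 ↔ x = p ∨ x = q := by
    intro x hx
    rw [gradient_saddlePairFn_eq_zero_iff (htwist k _), ← hψp, ← hψq, ψ.injOn.eq_iff hx hp,
      ψ.injOn.eq_iff hx hq]
  set C := ψ.source ∩ ψ ⁻¹' K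
  have hC : IsClosed C := by
    have : C = ψ.symm '' K := by
      rw [ψ.symm_image_eq_source_inter_preimage hKt]
    rw [this]
    exact (hK.image_of_continuousOn (ψ.continuousOn_symm.mono hKt)).isClosed
  have hU : ψ.source ⊆ F.singᶜ := hsrc ▸ F.source_subset φ hφ
  -- in the chart `φ`, the foliation is given by the model function without critical points
  have hmodel : ∀ χ ∈ F.charts, ∀ x ∈ χ.source, x ∈ ψ.source →
      SameLevelGerm (lastCoord χ) (modelFn k (-1) ∘ ψ) x := by
    intro χ hχ x hx hxψ
    exact (F.sameLevelGerm hχ hφ hx (hsrc ▸ hxψ)).trans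
      (SameLevelGerm.of_const_mul hh (.of_forall hlast)).symm
  obtain ⟨F', hsing, hagree, hF'⟩ := F.exists_modification (P := {p, q}) (u := g ∘ ψ)
    ψ.open_source hC Set.inter_subset_left (Set.toFinite _) (by
      rintro x (rfl | rfl)
      · exact ⟨hp, by rw [Set.mem_preimage, hψp]; exact saddlePairCore_subset k lam hmem1⟩
      · exact ⟨hq, by rw [Set.mem_preimage, hψq]; exact saddlePairCore_subset k lam hmem2⟩) hU
    (by
      rintro x ⟨hx, hxP⟩
      obtain ⟨e', he', hxe', hlast'⟩ := exists_chart_last_eq hg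
        (fun h => hxP ((hcrit x hx).1 h))
      exact ⟨ψ.trans e', trans_mem_maximalAtlas hψ he', by simp [hx, hxe'],
        fun y _ => hlast' (ψ y)⟩)
    (by
      intro χ hχ x hx hxψ hxC
      refine (hmodel χ hχ x hx hxψ).trans (.of_eventuallyEq ?_)
      filter_upwards [ψ.open_source.mem_nhds hxψ, hC.isOpen_compl.mem_nhds hxC] with y hy hyC
      exact (saddlePairFn_of_notMem fun h => hyC ⟨hy, h⟩).symm)
  have hint : ∀ W, IsOpen W → W ⊆ ψ.source → F'.IsFirstIntegral W (g ∘ ψ) := fun W hW hWψ =>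
    F'.isFirstIntegral_of_sameLevelGerm hW fun χ hχ x hx hxW => hF' χ hχ x hx (hWψ hxW)
  have hndp : IsNondegCriticalPoint g (ψ p) (k + 1) :=
    hψp ▸ isNondegCriticalPoint_saddlePairFn_neg k lam
  have hndq : IsNondegCriticalPoint g (ψ q) k :=
    hψq ▸ isNondegCriticalPoint_saddlePairFn_pos k lam
  have hk0' : 0 < (k : ℕ) := hk0
  have hk' : (k : ℕ) < m := hk
  have hopen : ∀ x : M, IsOpen (ψ.source \ {x}) := fun x => ψ.open_source.sdiff isClosed_singleton
  refine ⟨F', p, q, ψ, g, -1, 1, K, hsrc ▸ hp, hsrc ▸ hq, hpq, hsing, ⟨?_, by omega, by omega⟩,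
    ⟨?_, by omega, by omega⟩, ⟨hψ, hp, hq, hg.contDiffOn, hint _ ψ.open_source subset_rfl,
      fun z _ => ?_, ?_, ?_⟩, hndp, hndq, hsrc, hK, hKt, hagree, by norm_num, one_pos,
    F.isFirstIntegral_of_sameLevelGerm ψ.open_source hmodel,
    fun z hz => saddlePairFn_of_notMem hz.2, by rw [hψp, Real.sqrt_one],
    by rw [hψq, Real.sqrt_one], ?_⟩
  · refine F'.isMorseSingularity_of_chart hψ hg (hopen q) Set.sdiff_subset ?_
      (fun x hx => ?_) hndp (hint _ (hopen q) Set.sdiff_subset)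
    · rw [hsing]
      ext x
      constructor
      · rintro ⟨⟨hx, hxq⟩, h | h | h⟩
        exacts [absurd h (hU hx), h, absurd h hxq]
      · rintro rfl
        exact ⟨⟨hp, hpq⟩, .inr (.inl rfl)⟩
    · rw [hcrit x hx.1, or_iff_left (show ¬ x = q from hx.2)]
  · refine F'.isMorseSingularity_of_chart hψ hg (hopen p) Set.sdiff_subset ?_
      (fun x hx => ?_) hndq (hint _ (hopen p) Set.sdiff_subset)
    · rw [hsing]
      ext x
      constructor
      · rintro ⟨⟨hx, hxp⟩, h | h | h⟩
        exacts [absurd h (hU hx), absurd h hxp, h]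
      · rintro rfl
        exact ⟨⟨hq, hpq.symm⟩, .inr (.inr rfl)⟩
    · rw [hcrit x hx.1, or_iff_right (show ¬ x = p from hx.2)]
  · rw [hψp, hψq]
    exact gradient_saddlePairFn_eq_zero_iff (htwist k z)
  · rw [hψp, hψq]
    exact gradStable_inter_gradUnstable_nonempty hlam hcore
  · rw [hψp, hψq]
    exact intersectTransversely_saddlePairFn hlam (htwist k) hcore
  · rw [hψp, hψq, Filter.eventually_iff, mem_nhdsSet_iff_forall]
    rintro z ⟨a, c, ha, hc, hac, rfl⟩
    have hz : a • (EuclideanSpace.single k (-1) : RSp m) + c • EuclideanSpace.single k 1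
        = EuclideanSpace.single k (c - a) := by
      ext i
      by_cases hi : i = k
      · subst hi
        simp
        ring
      · simp [hi]
    rw [hz]
    exact saddlePairFn_eventuallyEq (hmem _ (by nlinarith))
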